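/- **Conventions.** An almost Hermitian structure on a smooth manifold $M$ is a pair $(\langle\cdot,\cdot\rangle, J)$ of a smooth Riemannian metric and a smooth almost complex structure with $\langle JX,JY\rangle=\langle X,Y\rangle$. Put $\omega(X,Y)=\langle JX,Y\rangle$ and $$N(X,Y)=J[JX,Y]+J[X,JY]+[X,Y]-[JX,JY],$$ and let $(d\omega)^+$ be the part of type $(2,1)+(1,2)$ of $d\omega$. Let $\theta^c,\theta^b$ be the $TM$-valued $2$-forms given by $$\langle\theta^c(X,Y),Z\rangle=\tfrac12\big[(d\omega)^+(X,Y,JZ)-(d\omega)^+(JX,JY,JZ)\big],\qquad \langle\theta^b(X,Y),Z\rangle=(d\omega)^+(JX,JY,JZ).$$ A connection $\nabla$ on $TM$ is Hermitian if it preserves the metric and $J$. For $t\in\mathbb R$, the $t$-Gauduchon connection $\nabla^t$ is the Hermitian connection whose torsion $T^t(X,Y)=\nabla^t_XY-\nabla^t_YX-[X,Y]$ satisfies $$\langle T^t(X,Y),Z\rangle=-\tfrac14\langle N(X,Y),Z\rangle+\left(1-\tfrac t2\right)\langle\theta^c(X,Y),Z\rangle+\tfrac t2\langle\theta^b(X,Y),Z\rangle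 .$$ On a Lie group, a connection is called trivial if $\nabla_XY=0$ for all left-invariant vector fields $X,Y$. **Theorem.** Let $H$ be a compact Lie group of dimension $n$ with Lie algebra $\mathfrak h$, and let $A$ be an abelian Lie group of dimension $n$ with Lie algebra $\mathfrak a$. Then the product Lie group $G=H\times A$, with $\mathfrak g=\mathfrak h\oplus\mathfrak a$, admits a left-invariant almost Hermitian structure $(\langle\cdot,\cdot\rangle,J)$ such that 1. $J$ is totally real with respect to $\mathfrak h$, that is, $J\mathfrak h=\mathfrak a$; moreover $\mathfrak h\perp\mathfrak a$; 2. the Gauduchon connection $\nabla^2$ exists, is the trivial connection, and has totally skew-symmetric torsion, that is, $\langle T^2(X,Y),Z\rangle$ is totally skew-symmetric in $X,Y,Z$; 3. the Gauduchon connection $\nabla^{-2}$ exists and is flat, and if $\mathfrak h$ is not abelian, then $\nabla^{-2}$ is not the trivial connection; 4. the $3$-form $\beta(X,Y,Z)=\langle T^B(X,Y),Z\rangle$, where $T^B=T^2$, is closed, $d\beta=0$ (the SKT condition). -/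

import Mathlib

open scoped Manifold ContDiff Bundle

noncomputable section

namespace AlmostHermitian

section Manifold

variable {E : Type*} [NormedAddCommGroup E] [NormedSpace ℝ E]
  {HM : Type*} [TopologicalSpace HM] (I : ModelWithCorners ℝ E HM)
  (M : Type*) [TopologicalSpace M] [ChartedSpace HM M] [IsManifold I ∞ M]

/-- (Not necessarily smooth) vector fields on `M`. -/
abbrev VecField : Type _ := (x : M) → TangentSpace I x

variable {I M}

/-- `X` is a `C^∞` vector field. -/
def IsSmoothField (X : VecField I M) : Prop :=
  ContMDiff I (I.prod 𝓘(ℝ, E)) ∞ (fun x ↦ (Bundle.TotalSpace.mk' E x (X x) : TangentBundle I M))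

/-- The function `X f : x ↦ df_x (X_x)`. -/
def lieDeriv (X : VecField I M) (f : M → ℝ) : M → ℝ :=
  fun x ↦ mvfderiv I f x (X x)

/-- Exterior derivative of a `2`-form `η`, evaluated on vector fields (invariant formula, without
numerical factor):
`dη(X,Y,Z) = X η(Y,Z) - Y η(X,Z) + Z η(X,Y) - η([X,Y],Z) + η([X,Z],Y) - η([Y,Z],X)`. -/
def extDerivTwo (η : (x : M) → TangentSpace I x → TangentSpace I x → ℝ)
    (X Y Z : VecField I M) (x : M) : ℝ :=
  lieDeriv X (fun y ↦ η y (Y y) (Z y)) x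
    - lieDeriv Y (fun y ↦ η y (X y) (Z y)) x
    + lieDeriv Z (fun y ↦ η y (X y) (Y y)) x
    - η x (VectorField.mlieBracket I X Y x) (Z x)
    + η x (VectorField.mlieBracket I X Z x) (Y x)
    - η x (VectorField.mlieBracket I Y Z x) (X x)

/-- Exterior derivative of a `3`-form `η`, evaluated on vector fields (invariant formula, without
numerical factor). -/
def extDerivThree
    (η : (x : M) → TangentSpace I x → TangentSpace I x → TangentSpace I x → ℝ)
    (W X Y Z : VecField I M) (x : M) : ℝ :=
  lieDeriv W (fun y ↦ η y (X y) (Y y) (Z y)) x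
    - lieDeriv X (fun y ↦ η y (W y) (Y y) (Z y)) x
    + lieDeriv Y (fun y ↦ η y (W y) (X y) (Z y)) x
    - lieDeriv Z (fun y ↦ η y (W y) (X y) (Y y)) x
    - η x (VectorField.mlieBracket I W X x) (Y x) (Z x)
    + η x (VectorField.mlieBracket I W Y x) (X x) (Z x)
    - η x (VectorField.mlieBracket I W Z x) (X x) (Y x)
    - η x (VectorField.mlieBracket I X Y x) (W x) (Z x)
    + η x (VectorField.mlieBracket I X Z x) (W x) (Y x)
    - η x (VectorField.mlieBracket I Y Z x) (W x) (X x)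

/-- The `3`-form `η` is closed: `dη = 0`. -/
def IsClosedThree
    (η : (x : M) → TangentSpace I x → TangentSpace I x → TangentSpace I x → ℝ) : Prop :=
  ∀ W X Y Z : VecField I M, IsSmoothField W → IsSmoothField X → IsSmoothField Y →
    IsSmoothField Z → ∀ x, extDerivThree η W X Y Z x = 0

/-- `η` is totally skew-symmetric (it changes sign under the two adjacent transpositions, hence
under every transposition of its arguments). -/
def IsTotallySkew
    (η : (x : M) → TangentSpace I x → TangentSpace I x → TangentSpace I x → ℝ) : Prop :=
  ∀ (x : M) (u v w : TangentSpace I x),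
    η x v u w = - η x u v w ∧ η x u w v = - η x u v w

end Manifold

/-- An almost Hermitian structure on the smooth manifold `M`: a smooth Riemannian metric `g` and a
smooth almost complex structure `J` with `g(J·, J·) = g(·, ·)`. -/
structure AlmostHermitianStructure {E : Type*} [NormedAddCommGroup E] [NormedSpace ℝ E]
    {HM : Type*} [TopologicalSpace HM] (I : ModelWithCorners ℝ E HM)
    (M : Type*) [TopologicalSpace M] [ChartedSpace HM M] [IsManifold I ∞ M] where
  /-- The Riemannian metric. -/
  g : Bundle.ContMDiffRiemannianMetric I ∞ E (fun x : M ↦ TangentSpace I x)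
  /-- The almost complex structure. -/
  J : (x : M) → TangentSpace I x →L[ℝ] TangentSpace I x
  smooth_J : ContMDiff I (I.prod 𝓘(ℝ, E →L[ℝ] E)) ∞
    (fun x ↦ Bundle.TotalSpace.mk' (E →L[ℝ] E)
      (E := fun x : M ↦ TangentSpace I x →L[ℝ] TangentSpace I x) x (J x))
  J_sq : ∀ (x : M) (v : TangentSpace I x), J x (J x v) = -v
  J_isometry : ∀ (x : M) (u v : TangentSpace I x), g.inner x (J x u) (J x v) = g.inner x u v

section Structure

variable {E : Type*} [NormedAddCommGroup E] [NormedSpace ℝ E]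
  {HM : Type*} [TopologicalSpace HM] {I : ModelWithCorners ℝ E HM}
  {M : Type*} [TopologicalSpace M] [ChartedSpace HM M] [IsManifold I ∞ M]

/-- The vector field `J X`. -/
def AlmostHermitianStructure.JField (S : AlmostHermitianStructure I M) (X : VecField I M) :
    VecField I M :=
  fun x ↦ S.J x (X x)

/-- The fundamental `2`-form `ω(u, v) = g(J u, v)`. -/
def AlmostHermitianStructure.fundForm (S : AlmostHermitianStructure I M) (x : M)
    (u v : TangentSpace I x) : ℝ :=
  S.g.inner x (S.J x u) v

/-- `dω(X, Y, Z)`. -/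
def AlmostHermitianStructure.dFund (S : AlmostHermitianStructure I M)
    (X Y Z : VecField I M) (x : M) : ℝ :=
  extDerivTwo S.fundForm X Y Z x

/-- `(dω)⁺(X, Y, Z)`, the part of type `(2,1)+(1,2)` of `dω`. For a real `3`-form `η` the
`(3,0)+(0,3)`-part is `(X,Y,Z) ↦ η(X⁺,Y⁺,Z⁺) + η(X⁻,Y⁻,Z⁻)` with `X^± = (X ∓ i J X) / 2`, that is
`(η(X,Y,Z) - η(JX,JY,Z) - η(JX,Y,JZ) - η(X,JY,JZ)) / 4`; what follows is the rest of `η`. -/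
def AlmostHermitianStructure.dFundPlus (S : AlmostHermitianStructure I M)
    (X Y Z : VecField I M) (x : M) : ℝ :=
  (1 / 4) * (3 * S.dFund X Y Z x + S.dFund (S.JField X) (S.JField Y) Z x
    + S.dFund (S.JField X) Y (S.JField Z) x + S.dFund X (S.JField Y) (S.JField Z) x)

/-- The Nijenhuis tensor `N(X, Y) = J[JX, Y] + J[X, JY] + [X, Y] - [JX, JY]`. -/
def AlmostHermitianStructure.nijenhuis (S : AlmostHermitianStructure I M)
    (X Y : VecField I M) : VecField I M :=
  fun x ↦ S.J x (VectorField.mlieBracket I (S.JField X) Y x)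
    + S.J x (VectorField.mlieBracket I X (S.JField Y) x)
    + VectorField.mlieBracket I X Y x
    - VectorField.mlieBracket I (S.JField X) (S.JField Y) x

/-- `g(θᶜ(X, Y), Z) = ((dω)⁺(X, Y, JZ) - (dω)⁺(JX, JY, JZ)) / 2`. -/
def AlmostHermitianStructure.thetaC (S : AlmostHermitianStructure I M)
    (X Y Z : VecField I M) (x : M) : ℝ :=
  (1 / 2) * (S.dFundPlus X Y (S.JField Z) x
    - S.dFundPlus (S.JField X) (S.JField Y) (S.JField Z) x)

/-- `g(θᵇ(X, Y), Z) = (dω)⁺(JX, JY, JZ)`. -/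
def AlmostHermitianStructure.thetaB (S : AlmostHermitianStructure I M)
    (X Y Z : VecField I M) (x : M) : ℝ :=
  S.dFundPlus (S.JField X) (S.JField Y) (S.JField Z) x

/-- The vector field `∇_X Y`. -/
def cov (D : CovariantDerivative I E (fun x : M ↦ TangentSpace I x)) (X Y : VecField I M) :
    VecField I M :=
  fun x ↦ D Y x (X x)

/-- The smooth connection `D` on `TM` is flat: `[∇_X, ∇_Y]Z - ∇_{[X,Y]}Z = 0`. -/
def IsFlat (D : CovariantDerivative I E (fun x : M ↦ TangentSpace I x)) : Prop :=
  ∀ X Y Z : VecField I M, IsSmoothField X → IsSmoothField Y → IsSmoothField Z → ∀ x,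
    cov D X (cov D Y Z) x - cov D Y (cov D X Z) x
      - cov D (VectorField.mlieBracket I X Y) Z x = 0

/-- `D` is a Hermitian connection: a smooth connection with `∇g = 0` and `∇J = 0`. -/
structure AlmostHermitianStructure.IsHermitian (S : AlmostHermitianStructure I M)
    (D : CovariantDerivative I E (fun x : M ↦ TangentSpace I x)) : Prop where
  smooth : CovariantDerivative.ContMDiffCovariantDerivative D ∞
  metric : ∀ X Y Z : VecField I M, IsSmoothField X → IsSmoothField Y → IsSmoothField Z → ∀ x,
    lieDeriv X (fun y ↦ S.g.inner y (Y y) (Z y)) x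
      = S.g.inner x (cov D X Y x) (Z x) + S.g.inner x (Y x) (cov D X Z x)
  complex : ∀ X Y : VecField I M, IsSmoothField X → IsSmoothField Y → ∀ x,
    cov D X (S.JField Y) x = S.J x (cov D X Y x)

variable [FiniteDimensional ℝ E]

/-- The trilinear form `(u, v, w) ↦ g(T(u, v), w)`, where `T` is the torsion of `D`. -/
def AlmostHermitianStructure.torsionForm (S : AlmostHermitianStructure I M)
    (D : CovariantDerivative I E (fun x : M ↦ TangentSpace I x)) (x : M)
    (u v w : TangentSpace I x) : ℝ :=
  S.g.inner x (D.torsion x u v) w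

/-- `D` is the `t`-Gauduchon connection: the Hermitian connection whose torsion satisfies
`g(T(X,Y),Z) = -g(N(X,Y),Z)/4 + (1 - t/2) g(θᶜ(X,Y),Z) + (t/2) g(θᵇ(X,Y),Z)`. -/
structure AlmostHermitianStructure.IsGauduchon (S : AlmostHermitianStructure I M) (t : ℝ)
    (D : CovariantDerivative I E (fun x : M ↦ TangentSpace I x)) : Prop
    extends S.IsHermitian D where
  torsion_eq : ∀ X Y Z : VecField I M, IsSmoothField X → IsSmoothField Y → IsSmoothField Z →
    ∀ x, S.torsionForm D x (X x) (Y x) (Z x)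
      = -(1 / 4) * S.g.inner x (S.nijenhuis X Y x) (Z x)
        + (1 - t / 2) * S.thetaC X Y Z x + (t / 2) * S.thetaB X Y Z x

end Structure

section Group

variable {E : Type*} [NormedAddCommGroup E] [NormedSpace ℝ E]
  {HM : Type*} [TopologicalSpace HM] {I : ModelWithCorners ℝ E HM}
  {G : Type*} [TopologicalSpace G] [ChartedSpace HM G] [IsManifold I ∞ G] [Group G]

/-- `g` and `J` are invariant under all left translations. -/
structure AlmostHermitianStructure.IsLeftInvariant (S : AlmostHermitianStructure I G) : Prop where
  metric : ∀ (a x : G) (u v : TangentSpace I x),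
    S.g.inner (a * x) (mfderiv I I (fun y ↦ a * y) x u) (mfderiv I I (fun y ↦ a * y) x v)
      = S.g.inner x u v
  complex : ∀ (a x : G) (u : TangentSpace I x),
    S.J (a * x) (mfderiv I I (fun y ↦ a * y) x u) = mfderiv I I (fun y ↦ a * y) x (S.J x u)

/-- `D` is the trivial left-invariant connection: `∇_X Y = 0` for all left-invariant `X`, `Y`. -/
def IsTrivialConnection (D : CovariantDerivative I E (fun x : G ↦ TangentSpace I x)) : Prop :=
  ∀ u v : GroupLieAlgebra I G, ∀ x : G,
    cov D (mulInvariantVectorField u) (mulInvariantVectorField v) x = 0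

end Group

section Product

variable {E : Type*} [NormedAddCommGroup E] [NormedSpace ℝ E]
  {HM : Type*} [TopologicalSpace HM] (I : ModelWithCorners ℝ E HM)
  (H : Type*) [TopologicalSpace H] [ChartedSpace HM H] [Group H]
  {E' : Type*} [NormedAddCommGroup E'] [NormedSpace ℝ E']
  {HM' : Type*} [TopologicalSpace HM'] (I' : ModelWithCorners ℝ E' HM')
  (A : Type*) [TopologicalSpace A] [ChartedSpace HM' A] [Group A]

/-- The Lie algebra of `H`, as a subspace of the Lie algebra `T_1(H × A)` of `H × A`. -/
def lieFst : Submodule ℝ (GroupLieAlgebra (I.prod I') (H × A)) :=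
  LinearMap.range (mfderiv I (I.prod I') (fun h : H ↦ (h, (1 : A))) (1 : H)).toLinearMap

/-- The Lie algebra of `A`, as a subspace of the Lie algebra `T_1(H × A)` of `H × A`. -/
def lieSnd : Submodule ℝ (GroupLieAlgebra (I.prod I') (H × A)) :=
  LinearMap.range (mfderiv I' (I.prod I') (fun a : A ↦ ((1 : H), a)) (1 : A)).toLinearMap

end Product

end AlmostHermitian

end

open scoped Manifold ContDiff Bundle Topology

noncomputable section

set_option linter.unusedSectionVars false

namespace AlmostHermitian

open VectorField Filter

/-! ### The Lie bracket as a commutator of derivations, and its naturality under smooth maps. -/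

section BracketFormula

variable {E : Type*} [NormedAddCommGroup E] [NormedSpace ℝ E] [CompleteSpace E]
  {HM : Type*} [TopologicalSpace HM] {I : ModelWithCorners ℝ E HM} [I.Boundaryless]
  {M : Type*} [TopologicalSpace M] [ChartedSpace HM M] [IsManifold I ∞ M]
  {F : Type*} [NormedAddCommGroup F] [NormedSpace ℝ F]

/-! Averaging over the compact group `H` gives an `ad`-invariant scalar product `B` on `𝔥`. Any
linear isomorphism `𝔞 ≃ 𝔥` then turns `𝔤` into `𝔥 × 𝔥`, with scalar product `B ⊕ B`, complex
structure `J (x, y) = (-y, x)`, and a bracket that sees only the first factor, because `𝔞` is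
abelian. This data, extended by left translation, is the required structure.

In the left-invariant framing the metric, `J` and the bracket have constant components, so `dω`, the
Nijenhuis tensor and the torsion of a connection with constant Christoffel symbols `Γ` become
algebraic expressions on `𝔥 × 𝔥`. Since `B([x, y], z)` is alternating, the Gauduchon torsion
equation is a linear identity between a few of its values. For `t = 2` it is solved by `Γ = 0`, with
torsion `-[u, v]` (`gauduchonForm_two`). For `t = -2` it is solved by letting the `𝔥`-component of
`u` act by `ad` on both factors (`gauduchonForm_neg_two`). This action is skew by invariance,
commutes with `J` because it is diagonal, and is a representation by the Jacobi identity, so the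
connection is flat. It is nonzero as soon as `𝔥` is not abelian.

The torsion form for `t = 2` is minus the Cartan 3-form `⟨[u, v], w⟩` of an invariant scalar
product; it is alternating, and closed by Jacobi (`isClosedThree_bracket`). Finally, a metric
connection is determined by its torsion (`cov_unique`), so these properties pass to every connection
satisfying the Gauduchon conditions.

The link between group and algebra is that left- and right-invariant fields commute. This yields the
derivative of `Ad` at the identity, hence `ad`-invariance of the average and vanishing of the
bracket of `𝔞`. -/

omit [CompleteSpace E] [I.Boundaryless] [IsManifold I ∞ M] in
lemma mvfderiv_comp_apply' {E' : Type*} [NormedAddCommGroup E'] [NormedSpace ℝ E']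
    {HM' : Type*} [TopologicalSpace HM'] {I' : ModelWithCorners ℝ E' HM'}
    {M' : Type*} [TopologicalSpace M'] [ChartedSpace HM' M'] {g : M' → F} {f : M → M'} (x : M)
    (hg : MDifferentiableAt I' 𝓘(ℝ, F) g (f x)) (hf : MDifferentiableAt I I' f x)
    (v : TangentSpace I x) :
    mvfderiv I (g ∘ f) x v = mvfderiv I' g (f x) (mfderiv I I' f x v) :=
  mfderiv_comp_apply x hg hf v

omit [CompleteSpace E] in
lemma mvfderiv_eq_fderiv (f : E → F) (y v : E) :
    mvfderiv 𝓘(ℝ, E) f y v = fderiv ℝ f y v := by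
  unfold mvfderiv
  have h := mfderiv_eq_fderiv (𝕜 := ℝ) (f := f) (x := y)
  exact congrArg (fun L : E →L[ℝ] F ↦ L v) h

omit [CompleteSpace E] in
lemma mfderiv_extChartAt_symm_self (x : M) (v : E) :
    mfderiv 𝓘(ℝ, E) I (extChartAt I x).symm (extChartAt I x x) v = (v : E) := by
  have h2 := mfderivWithin_range_extChartAt_symm (I := I) (x := x)
  rw [I.range_eq_univ, mfderivWithin_univ] at h2
  exact congrArg (fun L : E →L[ℝ] E ↦ L v) h2

omit [CompleteSpace E] in
lemma fderiv_comp_extChartAt_symm_apply {f : M → F} {x : M}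
    (hf : MDifferentiableAt I 𝓘(ℝ, F) f x) (v : E) :
    fderiv ℝ (f ∘ (extChartAt I x).symm) (extChartAt I x x) v = mvfderiv I f x v := by
  rw [← extChartAt_to_inv (I := I) x] at hf
  have hs : MDifferentiableAt 𝓘(ℝ, E) I (extChartAt I x).symm (extChartAt I x x) := by
    have := mdifferentiableWithinAt_extChartAt_symm (I := I) (mem_extChartAt_target (I := I) x)
    rwa [I.range_eq_univ, mdifferentiableWithinAt_univ] at this
  rw [← mvfderiv_eq_fderiv]
  refine (mvfderiv_comp_apply' _ hf hs v).trans ?_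
  have h3 : ∀ z, z = x → ∀ v w : E, v = w → mvfderiv I f z v = mvfderiv I f x w := by
    rintro z rfl v w rfl; rfl
  exact h3 _ (extChartAt_to_inv x) _ _ (mfderiv_extChartAt_symm_self (I := I) x _)

/-- The vector field `X` read in the extended chart at `x`. -/
def chartField (X : VecField I M) (x : M) : E → E :=
  mpullbackWithin 𝓘(ℝ, E) I (extChartAt I x).symm X (Set.range I)

-- The tangent space at `x` is identified with `E` through the preferred chart at `x`, so the
-- differential of that chart at `x` is the identity and the pullback back to `M` changes nothing.
omit [CompleteSpace E] in
lemma mlieBracket_eq_lieBracket_chartField (X Y : VecField I M) (x : M) :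
    mlieBracket I X Y x =
      lieBracket ℝ (chartField X x) (chartField Y x) (extChartAt I x x) := by
  rw [← mlieBracketWithin_univ, mlieBracketWithin_apply, I.range_eq_univ]
  simp only [Set.preimage_univ, Set.univ_inter]
  refine (congrArg (fun L : E →L[ℝ] E ↦ L.inverse _) (mfderiv_extChartAt_self (I := I))).trans ?_
  refine (congrArg (fun L : E →L[ℝ] E ↦ L _)
    (ContinuousLinearMap.inverse_id (R := ℝ) (M := E))).trans ?_
  unfold chartField
  rw [I.range_eq_univ]
  exact congrFun (lieBracketWithin_univ (𝕜 := ℝ) (E := E)) _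

omit [CompleteSpace E] [I.Boundaryless] in
lemma chartField_self (X : VecField I M) (x : M) :
    chartField X x (extChartAt I x x) = X x := by
  refine (mfderivWithin_extChartAt_symm_inverse_apply (I := I) (x := x)
    (X ((extChartAt I x).symm (extChartAt I x x)))).trans ?_
  have h : ∀ z, z = x → (X z : E) = X x := by rintro z rfl; rfl
  exact h _ (extChartAt_to_inv x)

lemma differentiableAt_chartField {X : VecField I M} {x : M}
    (hX : MDifferentiableAt I (I.prod 𝓘(ℝ, E))
      (fun y ↦ (Bundle.TotalSpace.mk' E y (X y) : TangentBundle I M)) x) :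
    DifferentiableAt ℝ (chartField X x) (extChartAt I x x) := by
  rw [← mdifferentiableWithinAt_univ] at hX
  have h := hX.differentiableWithinAt_mpullbackWithin_vectorField
  rw [Set.preimage_univ, Set.univ_inter] at h
  exact h.differentiableAt (by simp [I.range_eq_univ])

-- Needed on a whole neighbourhood, and not only at the base point, because both sides are
-- differentiated once more.
omit [CompleteSpace E] in
lemma eventually_fderiv_chartField (X : VecField I M) {f : M → F} {x : M}
    (hf : ContMDiffAt I 𝓘(ℝ, F) 2 f x) :
    ∀ᶠ y in 𝓝 (extChartAt I x x),
      fderiv ℝ (f ∘ (extChartAt I x).symm) y (chartField X x y) =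
        mvfderiv I f ((extChartAt I x).symm y) (X ((extChartAt I x).symm y)) := by
  have h1 : ∀ᶠ y in 𝓝 (extChartAt I x x), y ∈ (extChartAt I x).target :=
    extChartAt_target_mem_nhds x
  have h2 : ∀ᶠ y in 𝓝 (extChartAt I x x),
      MDifferentiableAt I 𝓘(ℝ, F) f ((extChartAt I x).symm y) := by
    have : ∀ᶠ z in 𝓝 x, ContMDiffAt I 𝓘(ℝ, F) 2 f z := 
      (contMDiffAt_iff_contMDiffAt_nhds (by simp)).1 hf
    have hc := (continuousAt_extChartAt_symm (I := I) x)
    rw [ContinuousAt, extChartAt_to_inv] at hc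
    exact (hc.eventually this).mono fun y hy ↦ hy.mdifferentiableAt (by simp)
  filter_upwards [h1, h2] with y hy hfy
  have hs : MDifferentiableAt 𝓘(ℝ, E) I (extChartAt I x).symm y := by
    have := mdifferentiableWithinAt_extChartAt_symm (I := I) hy
    rwa [I.range_eq_univ, mdifferentiableWithinAt_univ] at this
  have hinv : (mfderivWithin 𝓘(ℝ, E) I (extChartAt I x).symm (Set.range I) y).IsInvertible :=
    isInvertible_mfderivWithin_extChartAt_symm hy
  have h3 : fderiv ℝ (f ∘ (extChartAt I x).symm) y (chartField X x y) =
      mvfderiv I f ((extChartAt I x).symm y)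
        (mfderiv 𝓘(ℝ, E) I (extChartAt I x).symm y (chartField X x y : E)) := by
    refine (mvfderiv_eq_fderiv (f ∘ (extChartAt I x).symm) y (chartField X x y)).symm.trans ?_
    exact mvfderiv_comp_apply' y hfy hs (chartField X x y : E)
  rw [h3]
  congr 1
  rw [I.range_eq_univ, mfderivWithin_univ] at hinv
  unfold chartField
  rw [mpullbackWithin_apply, I.range_eq_univ, mfderivWithin_univ]
  exact hinv.self_apply_inverse _

omit [CompleteSpace E] in
lemma contDiffAt_comp_extChartAt_symm {f : M → F} {x : M}
    (hf : ContMDiffAt I 𝓘(ℝ, F) 2 f x) :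
    ContDiffAt ℝ 2 (f ∘ (extChartAt I x).symm) (extChartAt I x x) := by
  rw [← contMDiffAt_iff_contDiffAt]
  have hs : ContMDiffAt 𝓘(ℝ, E) I 2 (extChartAt I x).symm (extChartAt I x x) :=
    (contMDiffOn_extChartAt_symm x).contMDiffAt (extChartAt_target_mem_nhds x)
  exact ContMDiffAt.comp _ (by rwa [extChartAt_to_inv]) hs

/-- The derivative of a `C^2` function along a differentiable field is differentiable. -/
lemma mdifferentiableAt_mvfderiv_apply {X : VecField I M} {f : M → F} {x : M}
    (hf : ContMDiffAt I 𝓘(ℝ, F) 2 f x)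
    (hX : MDifferentiableAt I (I.prod 𝓘(ℝ, E))
      (fun y ↦ (Bundle.TotalSpace.mk' E y (X y) : TangentBundle I M)) x) :
    MDifferentiableAt I 𝓘(ℝ, F) (fun y ↦ mvfderiv I f y (X y)) x := by
  have h1 : DifferentiableAt ℝ (fun y ↦ fderiv ℝ (f ∘ (extChartAt I x).symm) y (chartField X x y))
      (extChartAt I x x) :=
    (((contDiffAt_comp_extChartAt_symm hf).fderiv_right (m := 1) (by norm_num)).differentiableAt
      (by simp)).clm_apply (differentiableAt_chartField hX)
  have h2 := h1.mdifferentiableAt.comp x (mdifferentiableAt_extChartAt (I := I)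
    (mem_chart_source HM x))
  refine h2.congr_of_eventuallyEq ?_
  have h3 := (continuousAt_extChartAt (I := I) x).eventually (eventually_fderiv_chartField X hf)
  filter_upwards [h3, extChartAt_source_mem_nhds (I := I) x] with z hz hzs
  rw [Function.comp_apply, hz]
  have h : ∀ w, w = z → mvfderiv I f z (X z) = mvfderiv I f w (X w) := by rintro w rfl; rfl
  exact h _ ((extChartAt I x).left_inv hzs)

lemma fderiv_fderiv_chartField {X Y : VecField I M} {f : M → F} {x : M}
    (hf : ContMDiffAt I 𝓘(ℝ, F) 2 f x)
    (hX : MDifferentiableAt I (I.prod 𝓘(ℝ, E))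
      (fun y ↦ (Bundle.TotalSpace.mk' E y (X y) : TangentBundle I M)) x) :
    fderiv ℝ (fun y ↦ fderiv ℝ (f ∘ (extChartAt I x).symm) y (chartField X x y))
      (extChartAt I x x) (chartField Y x (extChartAt I x x)) =
      mvfderiv I (fun y ↦ mvfderiv I f y (X y)) x (Y x) := by
  have h0 : (fun y ↦ fderiv ℝ (f ∘ (extChartAt I x).symm) y (chartField X x y)) =ᶠ[𝓝
      (extChartAt I x x)] (fun y ↦ mvfderiv I f y (X y)) ∘ (extChartAt I x).symm :=
    eventually_fderiv_chartField X hf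
  rw [h0.fderiv_eq, chartField_self]
  exact fderiv_comp_extChartAt_symm_apply (mdifferentiableAt_mvfderiv_apply hf hX) _

/-- The Lie bracket of two vector fields acts on functions as the commutator of derivations. -/
lemma mvfderiv_mlieBracket {X Y : VecField I M} {f : M → F} {x : M}
    (hf : ContMDiffAt I 𝓘(ℝ, F) 2 f x)
    (hX : MDifferentiableAt I (I.prod 𝓘(ℝ, E))
      (fun y ↦ (Bundle.TotalSpace.mk' E y (X y) : TangentBundle I M)) x)
    (hY : MDifferentiableAt I (I.prod 𝓘(ℝ, E))
      (fun y ↦ (Bundle.TotalSpace.mk' E y (Y y) : TangentBundle I M)) x) :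
    mvfderiv I f x (mlieBracket I X Y x) =
      mvfderiv I (fun y ↦ mvfderiv I f y (Y y)) x (X x) -
        mvfderiv I (fun y ↦ mvfderiv I f y (X y)) x (Y x) := by
  have h := fderiv_apply_lieBracket (contDiffAt_comp_extChartAt_symm hf) (by simp)
    (differentiableAt_chartField hY) (differentiableAt_chartField hX)
  rw [fderiv_fderiv_chartField hf hX, fderiv_fderiv_chartField hf hY] at h
  rw [← h, mlieBracket_eq_lieBracket_chartField]
  exact (fderiv_comp_extChartAt_symm_apply (hf.mdifferentiableAt (by simp)) _).symm

omit [CompleteSpace E] [I.Boundaryless] in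
lemma IsSmoothField.mdifferentiableAt {X : VecField I M} (hX : IsSmoothField X) (x : M) :
    MDifferentiableAt I (I.prod 𝓘(ℝ, E))
      (fun y ↦ (Bundle.TotalSpace.mk' E y (X y) : TangentBundle I M)) x :=
  ContMDiff.mdifferentiableAt hX (by simp)

/-- The Lie bracket is natural with respect to smooth maps: the bracket of two pairs of `φ`-related
fields is `φ`-related. -/
lemma mfderiv_mlieBracket_of_related {E' : Type*} [NormedAddCommGroup E'] [NormedSpace ℝ E']
    [CompleteSpace E'] {HM' : Type*} [TopologicalSpace HM'] {I' : ModelWithCorners ℝ E' HM'}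
    [I'.Boundaryless] {M' : Type*} [TopologicalSpace M'] [ChartedSpace HM' M'] [IsManifold I' ∞ M']
    {φ : M → M'} (hφ : ContMDiff I I' ∞ φ) {X Y : VecField I M} {X' Y' : VecField I' M'}
    (hX : IsSmoothField X) (hY : IsSmoothField Y) (hX' : IsSmoothField X')
    (hY' : IsSmoothField Y') (hXX' : ∀ x, mfderiv I I' φ x (X x) = X' (φ x))
    (hYY' : ∀ x, mfderiv I I' φ x (Y x) = Y' (φ x)) (x : M) :
    mfderiv I I' φ x (mlieBracket I X Y x) = mlieBracket I' X' Y' (φ x) := by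
  -- Testing against a single vector-valued function suffices: the differential of this chart at `φ
  -- x` is the identity, so it determines a tangent vector there.
  set f : M' → E' := ⇑(extChartAt I' (φ x)) with hf_def
  have hf : ContMDiffAt I' 𝓘(ℝ, E') 2 f (φ x) := contMDiffAt_extChartAt
  have hφd : ∀ y, MDifferentiableAt I I' φ y := fun y ↦ hφ.mdifferentiableAt (by simp)
  have hfφ : ContMDiffAt I 𝓘(ℝ, E') 2 (f ∘ φ) x := hf.comp x ((hφ x).of_le (by norm_cast))
  have hev : ∀ᶠ y in 𝓝 x, MDifferentiableAt I' 𝓘(ℝ, E') f (φ y) := by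
    have h := (contMDiffAt_iff_contMDiffAt_nhds (by simp)).1 hf
    exact (hφ.continuous.continuousAt.eventually h).mono fun y hy ↦ hy.mdifferentiableAt (by simp)
  have key : ∀ (Z : VecField I M) (Z' : VecField I' M'),
      (∀ x, mfderiv I I' φ x (Z x) = Z' (φ x)) →
      (fun y ↦ mvfderiv I (f ∘ φ) y (Z y)) =ᶠ[𝓝 x] (fun y ↦ mvfderiv I' f y (Z' y)) ∘ φ := by
    intro Z Z' hZ
    filter_upwards [hev] with y hy
    rw [mvfderiv_comp_apply' y hy (hφd y), hZ]
    rfl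
  have key2 : ∀ (Z W : VecField I M) (Z' W' : VecField I' M'), IsSmoothField Z' →
      (∀ x, mfderiv I I' φ x (Z x) = Z' (φ x)) → (∀ x, mfderiv I I' φ x (W x) = W' (φ x)) →
      mvfderiv I (fun y ↦ mvfderiv I (f ∘ φ) y (Z y)) x (W x) =
        mvfderiv I' (fun y ↦ mvfderiv I' f y (Z' y)) (φ x) (W' (φ x)) := by
    intro Z W Z' W' hZ' hZ hW
    have h1 : mvfderiv I (fun y ↦ mvfderiv I (f ∘ φ) y (Z y)) x =
        mvfderiv I ((fun y ↦ mvfderiv I' f y (Z' y)) ∘ φ) x := (key Z Z' hZ).mfderiv_eq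
    rw [h1, mvfderiv_comp_apply' x (mdifferentiableAt_mvfderiv_apply hf
      (hZ'.mdifferentiableAt _)) (hφd x), hW]
  have h1 := mvfderiv_mlieBracket hfφ (hX.mdifferentiableAt x) (hY.mdifferentiableAt x)
  have h2 := mvfderiv_mlieBracket hf (hX'.mdifferentiableAt (φ x)) (hY'.mdifferentiableAt (φ x))
  rw [key2 Y X Y' X' hY' hYY' hXX', key2 X Y X' Y' hX' hXX' hYY', ← h2,
    mvfderiv_comp_apply' x hev.self_of_nhds (hφd x)] at h1
  have h3 : ∀ v : TangentSpace I' (φ x), mvfderiv I' f (φ x) v = v := fun v ↦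
    congrArg (fun L : E' →L[ℝ] E' ↦ L v) (mfderiv_extChartAt_self (I := I') (x := φ x))
  exact (h3 _).symm.trans (h1.trans (h3 _))

end BracketFormula

/-! ### Global framings: smoothness read on components. -/

section ClmSmooth

variable {E : Type*} [NormedAddCommGroup E] [NormedSpace ℝ E]
  {HM : Type*} [TopologicalSpace HM] {I : ModelWithCorners ℝ E HM}
  {M : Type*} [TopologicalSpace M] [ChartedSpace HM M]
  {V : Type*} [NormedAddCommGroup V] [NormedSpace ℝ V] [FiniteDimensional ℝ V]
  {F : Type*} [NormedAddCommGroup F] [NormedSpace ℝ F]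

/-- A family of linear maps on a finite-dimensional space is smooth as soon as it is pointwise. -/
lemma contMDiffAt_clm_of_apply {n : WithTop ℕ∞} {L : M → V →L[ℝ] F} {x : M}
    (h : ∀ v, ContMDiffAt I 𝓘(ℝ, F) n (fun y ↦ L y v) x) :
    ContMDiffAt I 𝓘(ℝ, V →L[ℝ] F) n L x := by
  let b := Module.finBasis ℝ V
  -- A linear map is rebuilt from its values on a basis by a fixed continuous linear operator.
  let Φ : (Fin (Module.finrank ℝ V) → F) →L[ℝ] (V →L[ℝ] F) :=
    ∑ i, (ContinuousLinearMap.smulRightL ℝ V F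
      (LinearMap.toContinuousLinearMap (b.coord i))).comp (ContinuousLinearMap.proj i)
  have hL : L = fun y ↦ Φ (fun i ↦ L y (b i)) := by
    ext y v
    calc L y v = L y (∑ i, b.repr v i • b i) := by rw [b.sum_repr]
      _ = ∑ i, b.repr v i • L y (b i) := by simp only [map_sum, map_smul]
      _ = Φ (fun i ↦ L y (b i)) v := by simp [Φ]
  rw [hL]
  refine Φ.contMDiff.contMDiffAt.comp x ?_
  exact contMDiffAt_pi_space.2 fun i ↦ h (b i)

end ClmSmooth

/-- A global framing of the tangent bundle of `M`, whose fields of constant components are closed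
under brackets. -/
structure Framing {E : Type*} [NormedAddCommGroup E] [NormedSpace ℝ E]
    {HM : Type*} [TopologicalSpace HM] (I : ModelWithCorners ℝ E HM)
    (M : Type*) [TopologicalSpace M] [ChartedSpace HM M] [IsManifold I ∞ M]
    (V : Type*) [NormedAddCommGroup V] [NormedSpace ℝ V] where
  /-- The identification of the tangent spaces with `V`. -/
  coframe : ∀ x : M, TangentSpace I x ≃L[ℝ] V
  smooth_symm : ∀ v : V, IsSmoothField (I := I) (M := M) (fun x ↦ (coframe x).symm v)
  /-- The structure constants. -/
  bracket : V →L[ℝ] V →L[ℝ] V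
  mlieBracket_eq : ∀ (u v : V) (x : M), VectorField.mlieBracket I (fun y ↦ (coframe y).symm u)
    (fun y ↦ (coframe y).symm v) x = (coframe x).symm (bracket u v)

namespace Framing

variable {E : Type*} [NormedAddCommGroup E] [NormedSpace ℝ E] [FiniteDimensional ℝ E]
  {HM : Type*} [TopologicalSpace HM] {I : ModelWithCorners ℝ E HM}
  {M : Type*} [TopologicalSpace M] [ChartedSpace HM M] [IsManifold I ∞ M]
  {V : Type*} [NormedAddCommGroup V] [NormedSpace ℝ V] [FiniteDimensional ℝ V]
  (T : Framing I M V)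

/-- The components of a vector field in the framing. -/
def comp (X : VecField I M) : M → V := fun x ↦ T.coframe x (X x)

/-- The field with constant components `v`. -/
def field (v : V) : VecField I M := fun x ↦ (T.coframe x).symm v

/-- The frame read in the trivialization of the tangent bundle at `x₀`. -/
def frameCoord (x₀ x : M) : V →L[ℝ] E :=
  ((trivializationAt E (TangentSpace I : M → Type _) x₀).continuousLinearMapAt ℝ x).comp
    ((T.coframe x).symm : V →L[ℝ] TangentSpace I x)

/-- The coframe read in the trivialization of the tangent bundle at `x₀`. -/
def coframeCoord (x₀ x : M) : E →L[ℝ] V :=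
  ((T.coframe x : TangentSpace I x →L[ℝ] V)).comp
    ((trivializationAt E (TangentSpace I : M → Type _) x₀).symmL ℝ x)

omit [FiniteDimensional ℝ E] in
lemma eventually_mem_baseSet (x₀ : M) :
    ∀ᶠ x in 𝓝 x₀, x ∈ (trivializationAt E (TangentSpace I : M → Type _) x₀).baseSet :=
  (trivializationAt E (TangentSpace I : M → Type _) x₀).open_baseSet.mem_nhds
    (FiberBundle.mem_baseSet_trivializationAt' x₀)

lemma contMDiffAt_frameCoord (x₀ : M) :
    ContMDiffAt I 𝓘(ℝ, V →L[ℝ] E) ∞ (T.frameCoord x₀) x₀ := by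
  refine contMDiffAt_clm_of_apply fun v ↦ ?_
  have h : ContMDiffAt I 𝓘(ℝ, E) ∞ (fun x ↦ (trivializationAt E (TangentSpace I : M → Type _) x₀
      (Bundle.TotalSpace.mk' E x ((T.coframe x).symm v))).2) x₀ :=
    (Bundle.contMDiffAt_section x₀).1 ((T.smooth_symm v) x₀)
  refine h.congr_of_eventuallyEq ?_
  filter_upwards [eventually_mem_baseSet (I := I) x₀] with x hx
  simp only [frameCoord, ContinuousLinearMap.comp_apply]
  rw [Bundle.Trivialization.continuousLinearMapAt_apply, Bundle.Trivialization.coe_linearMapAt_of_mem _ hx]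
  rfl

lemma frameCoord_eq (x₀ : M) {x : M}
    (hx : x ∈ (trivializationAt E (TangentSpace I : M → Type _) x₀).baseSet) :
    T.frameCoord x₀ x = (((T.coframe x).symm.trans
      ((trivializationAt E (TangentSpace I : M → Type _) x₀).continuousLinearEquivAt ℝ x hx) :
        V ≃L[ℝ] E) : V →L[ℝ] E) := by
  ext v
  simp [frameCoord, Bundle.Trivialization.coe_continuousLinearEquivAt_eq _ hx]

lemma coframeCoord_eq_inverse (x₀ : M) {x : M}
    (hx : x ∈ (trivializationAt E (TangentSpace I : M → Type _) x₀).baseSet) :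
    T.coframeCoord x₀ x = (T.frameCoord x₀ x).inverse := by
  rw [T.frameCoord_eq x₀ hx, ContinuousLinearMap.inverse_equiv]
  ext v
  simp [coframeCoord, Bundle.Trivialization.symmL_apply _ hx]

/-- The coframe is the inverse of the smooth frame, and inversion of operators is smooth at
invertible ones. -/
lemma contMDiffAt_coframeCoord (x₀ : M) :
    ContMDiffAt I 𝓘(ℝ, E →L[ℝ] V) ∞ (T.coframeCoord x₀) x₀ := by
  have hx₀ := FiberBundle.mem_baseSet_trivializationAt' (F := E)
    (E := (TangentSpace I : M → Type _)) x₀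
  have : CompleteSpace V := FiniteDimensional.complete ℝ V
  have h1 : ContDiffAt ℝ ∞ ContinuousLinearMap.inverse (T.frameCoord x₀ x₀) := by
    rw [T.frameCoord_eq x₀ hx₀]
    exact contDiffAt_map_inverse _
  have h2 := h1.contMDiffAt.comp x₀ (T.contMDiffAt_frameCoord x₀)
  refine h2.congr_of_eventuallyEq ?_
  filter_upwards [eventually_mem_baseSet (I := I) x₀] with x hx
  exact T.coframeCoord_eq_inverse x₀ hx

omit [FiniteDimensional ℝ E] [FiniteDimensional ℝ V] in
lemma comp_eq_coframeCoord (X : VecField I M) (x₀ : M) {x : M}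
    (hx : x ∈ (trivializationAt E (TangentSpace I : M → Type _) x₀).baseSet) :
    T.comp X x = T.coframeCoord x₀ x
      (trivializationAt E (TangentSpace I : M → Type _) x₀ (Bundle.TotalSpace.mk' E x (X x))).2 := by
  simp only [comp, coframeCoord, ContinuousLinearMap.comp_apply, ContinuousLinearEquiv.coe_coe]
  congr 1
  rw [Bundle.Trivialization.symmL_apply _ hx]
  exact ((trivializationAt E (TangentSpace I : M → Type _) x₀).symm_apply_apply_mk hx (X x)).symm

lemma contMDiff_comp {X : VecField I M} (hX : IsSmoothField X) :
    ContMDiff I 𝓘(ℝ, V) ∞ (T.comp X) := by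
  intro x₀
  refine ((T.contMDiffAt_coframeCoord x₀).clm_apply
    ((Bundle.contMDiffAt_section x₀).1 (hX x₀))).congr_of_eventuallyEq ?_
  filter_upwards [eventually_mem_baseSet (I := I) x₀] with x hx
  exact T.comp_eq_coframeCoord X x₀ hx

lemma isSmoothField_of_comp {X : VecField I M} (hX : ContMDiff I 𝓘(ℝ, V) ∞ (T.comp X)) :
    IsSmoothField X := by
  intro x₀
  refine (Bundle.contMDiffAt_section x₀).2 ?_
  refine ((T.contMDiffAt_frameCoord x₀).clm_apply (hX x₀)).congr_of_eventuallyEq ?_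
  filter_upwards [eventually_mem_baseSet (I := I) x₀] with x hx
  simp only [frameCoord, comp, ContinuousLinearMap.comp_apply, ContinuousLinearEquiv.coe_coe,
    ContinuousLinearEquiv.symm_apply_apply]
  rw [Bundle.Trivialization.continuousLinearMapAt_apply, Bundle.Trivialization.coe_linearMapAt_of_mem _ hx]

/-- The field of endomorphisms with components `A`. -/
def endField (A : M → V →L[ℝ] V) (x : M) : TangentSpace I x →L[ℝ] TangentSpace I x :=
  ((T.coframe x).symm : V →L[ℝ] TangentSpace I x).comp
    ((A x).comp (T.coframe x : TangentSpace I x →L[ℝ] V))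

lemma contMDiff_endField {A : M → V →L[ℝ] V} (hA : ContMDiff I 𝓘(ℝ, V →L[ℝ] V) ∞ A) :
    ContMDiff I (I.prod 𝓘(ℝ, E →L[ℝ] E)) ∞
      (fun x ↦ Bundle.TotalSpace.mk' (E →L[ℝ] E)
        (E := fun x : M ↦ TangentSpace I x →L[ℝ] TangentSpace I x) x (T.endField A x)) := by
  intro x₀
  refine (contMDiffAt_hom_bundle _).2 ⟨contMDiffAt_id, ?_⟩
  exact (T.contMDiffAt_frameCoord x₀).clm_comp ((hA x₀).clm_comp (T.contMDiffAt_coframeCoord x₀))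

/-- The field of bilinear forms with constant components `B`. -/
def formField (B : V →L[ℝ] V →L[ℝ] ℝ) (x : M) :
    TangentSpace I x →L[ℝ] TangentSpace I x →L[ℝ] ℝ :=
  (ContinuousLinearMap.precomp ℝ (T.coframe x : TangentSpace I x →L[ℝ] V)).comp
    (B.comp (T.coframe x : TangentSpace I x →L[ℝ] V))

lemma formField_apply (B : V →L[ℝ] V →L[ℝ] ℝ) (x : M) (u v : TangentSpace I x) :
    T.formField B x u v = B (T.coframe x u) (T.coframe x v) := rfl

lemma contMDiff_formField (B : V →L[ℝ] V →L[ℝ] ℝ) :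
    ContMDiff I (I.prod 𝓘(ℝ, E →L[ℝ] E →L[ℝ] ℝ)) ∞
      (fun x ↦ Bundle.TotalSpace.mk' (E →L[ℝ] E →L[ℝ] ℝ)
        (E := fun x : M ↦ TangentSpace I x →L[ℝ] TangentSpace I x →L[ℝ] ℝ) x
        (T.formField B x)) := by
  intro x₀
  refine (contMDiffAt_hom_bundle _).2 ⟨contMDiffAt_id, ?_⟩
  refine contMDiffAt_clm_of_apply fun v ↦ contMDiffAt_clm_of_apply fun w ↦ ?_
  have h : ContMDiffAt I 𝓘(ℝ, ℝ) ∞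
      (fun x ↦ B (T.coframeCoord x₀ x v) (T.coframeCoord x₀ x w)) x₀ :=
    ((B.contMDiff.contMDiffAt (x := T.coframeCoord x₀ x₀ v)).comp x₀
      ((T.contMDiffAt_coframeCoord x₀).clm_apply contMDiffAt_const)).clm_apply
      ((T.contMDiffAt_coframeCoord x₀).clm_apply contMDiffAt_const)
  refine h.congr_of_eventuallyEq ?_
  filter_upwards [eventually_mem_baseSet (I := I) x₀] with x hx
  refine (inCoordinates_apply_eq₂ hx hx (by simp)).trans ?_
  simp [coframeCoord, formField_apply, Bundle.Trivialization.symmL_apply _ hx]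

end Framing

/-! ### Chain and product rules for vector-valued functions along vector fields. -/

section Derivative

variable {E : Type*} [NormedAddCommGroup E] [NormedSpace ℝ E]
  {HM : Type*} [TopologicalSpace HM] {I : ModelWithCorners ℝ E HM}
  {M : Type*} [TopologicalSpace M] [ChartedSpace HM M]
  {V₁ V₂ V₃ : Type*} [NormedAddCommGroup V₁] [NormedSpace ℝ V₁]
  [NormedAddCommGroup V₂] [NormedSpace ℝ V₂] [NormedAddCommGroup V₃] [NormedSpace ℝ V₃]

lemma mvfderiv_clm (L : V₁ →L[ℝ] V₂) {F : M → V₁} {x : M}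
    (hF : MDifferentiableAt I 𝓘(ℝ, V₁) F x) (v : TangentSpace I x) :
    mvfderiv I (fun y ↦ L (F y)) x v = L (mvfderiv I F x v) := by
  have h := mvfderiv_comp_apply' x (g := L) L.differentiableAt.mdifferentiableAt hF v
  refine h.trans ?_
  refine (mvfderiv_eq_fderiv (E := V₁) (F := V₂) _ _ _).trans ?_
  rw [L.fderiv]
  rfl

lemma mvfderiv_bilinear (b : V₁ →L[ℝ] V₂ →L[ℝ] V₃) {F : M → V₁} {G : M → V₂} {x : M}
    (hF : MDifferentiableAt I 𝓘(ℝ, V₁) F x) (hG : MDifferentiableAt I 𝓘(ℝ, V₂) G x)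
    (v : TangentSpace I x) :
    mvfderiv I (fun y ↦ b (F y) (G y)) x v =
      b (mvfderiv I F x v) (G x) + b (F x) (mvfderiv I G x v) := by
  have hb := b.isBoundedBilinearMap.hasFDerivAt (F x, G x)
  have hFG : MDifferentiableAt I 𝓘(ℝ, V₁ × V₂) (fun y ↦ (F y, G y)) x := hF.prodMk_space hG
  have h := mvfderiv_comp_apply' x (f := fun y ↦ (F y, G y))
    (g := fun p : V₁ × V₂ ↦ b p.1 p.2) hb.differentiableAt.mdifferentiableAt hFG v
  refine h.trans ?_
  refine (mvfderiv_eq_fderiv (E := V₁ × V₂) (F := V₃) _ _ _).trans ?_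
  rw [hb.fderiv]
  have h1 : mvfderiv I F x v = (mvfderiv I (fun y ↦ (F y, G y)) x v).1 :=
    mvfderiv_clm (ContinuousLinearMap.fst ℝ V₁ V₂) hFG v
  have h2 : mvfderiv I G x v = (mvfderiv I (fun y ↦ (F y, G y)) x v).2 :=
    mvfderiv_clm (ContinuousLinearMap.snd ℝ V₁ V₂) hFG v
  rw [h1, h2, add_comm]
  rfl

/-- The derivative of a smooth function along a smooth field is smooth. -/
lemma contMDiff_mvfderiv_apply [IsManifold I ∞ M] {F : M → V₁} (hF : ContMDiff I 𝓘(ℝ, V₁) ∞ F)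
    {X : VecField I M} (hX : IsSmoothField X) :
    ContMDiff I 𝓘(ℝ, V₁) ∞ (fun x ↦ mvfderiv I F x (X x)) := by
  have h1 : ContMDiff I 𝓘(ℝ, V₁).tangent ∞ (fun x ↦ tangentMap I 𝓘(ℝ, V₁) F
      (Bundle.TotalSpace.mk' E x (X x) : TangentBundle I M)) :=
    (hF.contMDiff_tangentMap (m := ∞) le_rfl).comp hX
  exact (contMDiff_snd_tangentBundle_modelSpace V₁ 𝓘(ℝ, V₁)).comp h1

end Derivative

/-! ### Connections with constant Christoffel symbols, and brackets in components. -/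

namespace Framing

variable {E : Type*} [NormedAddCommGroup E] [NormedSpace ℝ E] [FiniteDimensional ℝ E]
  {HM : Type*} [TopologicalSpace HM] {I : ModelWithCorners ℝ E HM}
  {M : Type*} [TopologicalSpace M] [ChartedSpace HM M] [IsManifold I ∞ M]
  {V : Type*} [NormedAddCommGroup V] [NormedSpace ℝ V] [FiniteDimensional ℝ V]
  (T : Framing I M V)

lemma mdifferentiableAt_comp {X : VecField I M} {x : M}
    (hX : MDifferentiableAt I (I.prod 𝓘(ℝ, E))
      (fun y ↦ (Bundle.TotalSpace.mk' E y (X y) : TangentBundle I M)) x) :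
    MDifferentiableAt I 𝓘(ℝ, V) (T.comp X) x := by
  have h := ((T.contMDiffAt_coframeCoord x).mdifferentiableAt (by simp)).clm_apply
    ((mdifferentiableAt_totalSpace I _).1 hX).2
  refine h.congr_of_eventuallyEq ?_
  filter_upwards [eventually_mem_baseSet (I := I) x] with y hy
  exact T.comp_eq_coframeCoord X x hy

lemma comp_field (v : V) : T.comp (T.field v) = fun _ ↦ v := by
  ext x; simp [comp, field]

lemma isSmoothField_field (v : V) : IsSmoothField (T.field v) := T.smooth_symm v

lemma comp_add (X Y : VecField I M) : T.comp (X + Y) = T.comp X + T.comp Y := by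
  ext x; simp [comp]

lemma comp_smul (f : M → ℝ) (X : VecField I M) : T.comp (f • X) = f • T.comp X := by
  ext x; simp [comp]

/-- The connection with constant Christoffel symbols `Γ` in the framing. -/
def conn (Γ : V →L[ℝ] V →L[ℝ] V) : CovariantDerivative I E (fun x : M ↦ TangentSpace I x) where
  toFun σ x := ((T.coframe x).symm : V →L[ℝ] TangentSpace I x).comp
    (mvfderiv I (T.comp σ) x + (Γ.flip (T.comp σ x)).comp
      (T.coframe x : TangentSpace I x →L[ℝ] V))
  isCovariantDerivativeOnUniv :=
    { add := by
        intro σ σ' x hσ hσ' _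
        ext v
        simp only [T.comp_add, mvfderiv_add (T.mdifferentiableAt_comp hσ)
          (T.mdifferentiableAt_comp hσ')]
        simp
        abel
      leibniz := by
        intro σ g x hσ hg _
        ext v
        simp only [T.comp_smul, mvfderiv_smul hg (T.mdifferentiableAt_comp hσ)]
        simp [comp]
        abel }

lemma coframe_conn (Γ : V →L[ℝ] V →L[ℝ] V) (Y : VecField I M) (x : M) (v : TangentSpace I x) :
    T.coframe x (T.conn Γ Y x v) =
      mvfderiv I (T.comp Y) x v + Γ (T.coframe x v) (T.comp Y x) := by
  simp [conn]

lemma comp_cov (Γ : V →L[ℝ] V →L[ℝ] V) (X Y : VecField I M) (x : M) :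
    T.comp (cov (T.conn Γ) X Y) x =
      mvfderiv I (T.comp Y) x (X x) + Γ (T.comp X x) (T.comp Y x) :=
  T.coframe_conn Γ Y x (X x)

lemma conn_field (Γ : V →L[ℝ] V →L[ℝ] V) (v : V) (x : M) (u : TangentSpace I x) :
    T.coframe x (T.conn Γ (T.field v) x u) = Γ (T.coframe x u) v := by
  rw [coframe_conn, comp_field, mvfderiv_const]
  simp

/-- Torsion is tensorial, so it may be evaluated on the fields with constant components through `u`
and `v`, where the derivative terms vanish. -/
lemma coframe_torsion (Γ : V →L[ℝ] V →L[ℝ] V) (x : M) (u v : TangentSpace I x) :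
    T.coframe x ((T.conn Γ).torsion x u v) = Γ (T.coframe x u) (T.coframe x v)
      - Γ (T.coframe x v) (T.coframe x u) - T.bracket (T.coframe x u) (T.coframe x v) := by
  have hu : u = T.field (T.coframe x u) x := by simp [field]
  have hv : v = T.field (T.coframe x v) x := by simp [field]
  have h := (T.conn Γ).torsion_apply
    ((T.isSmoothField_field (T.coframe x u)).mdifferentiableAt x)
    ((T.isSmoothField_field (T.coframe x v)).mdifferentiableAt x)
  have hb : mlieBracket I (T.field (T.coframe x u)) (T.field (T.coframe x v)) x =
    (T.coframe x).symm (T.bracket (T.coframe x u) (T.coframe x v)) := T.mlieBracket_eq _ _ x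
  rw [hb, ← hu, ← hv] at h
  rw [h]
  simp only [map_sub, conn_field, ContinuousLinearEquiv.apply_symm_apply]

/-- The components of the Lie bracket of two fields. -/
lemma comp_mlieBracket {X Y : VecField I M} (hX : IsSmoothField X) (hY : IsSmoothField Y) (x : M) :
    T.coframe x (mlieBracket I X Y x) = mvfderiv I (T.comp Y) x (X x)
      - mvfderiv I (T.comp X) x (Y x) + T.bracket (T.comp X x) (T.comp Y x) := by
  -- For `Γ = 0` the torsion is minus the constant bracket, while `∇_X Y` is the plain derivative of
  -- components; comparing the two expressions for the torsion gives the bracket of arbitrary smooth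
  -- fields.
  have h := (T.conn 0).torsion_apply (hX.mdifferentiableAt x) (hY.mdifferentiableAt x)
  have h' := congrArg (T.coframe x) h
  rw [coframe_torsion, map_sub, map_sub, coframe_conn, coframe_conn] at h'
  simp only [zero_apply, sub_self, zero_sub, add_zero] at h'
  have : ∀ a b c d : V, -a = b - c - d → b - c + a = d := by
    intro a b c d h
    rw [← sub_eq_zero] at h ⊢
    have h2 : b - c + a - d = -(-a - (b - c - d)) := by abel
    rw [h2, h, neg_zero]
  exact (this _ _ _ _ h').symm

lemma contMDiff_mvfderiv_comp {X Y : VecField I M} (hX : IsSmoothField X) (hY : IsSmoothField Y) :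
    ContMDiff I 𝓘(ℝ, V) ∞ (fun x ↦ mvfderiv I (T.comp Y) x (X x)) :=
  contMDiff_mvfderiv_apply (T.contMDiff_comp hY) hX

lemma isSmoothField_cov (Γ : V →L[ℝ] V →L[ℝ] V) {X Y : VecField I M} (hX : IsSmoothField X)
    (hY : IsSmoothField Y) : IsSmoothField (cov (T.conn Γ) X Y) := by
  refine T.isSmoothField_of_comp ?_
  have h : T.comp (cov (T.conn Γ) X Y) = fun x ↦ mvfderiv I (T.comp Y) x (X x) +
      Γ (T.comp X x) (T.comp Y x) := funext (T.comp_cov Γ X Y)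
  rw [h]
  exact (T.contMDiff_mvfderiv_comp hX hY).add
    ((Γ.contMDiff.comp (T.contMDiff_comp hX)).clm_apply (T.contMDiff_comp hY))

include T in
lemma isSmoothField_mlieBracket {X Y : VecField I M} (hX : IsSmoothField X)
    (hY : IsSmoothField Y) : IsSmoothField (mlieBracket I X Y) := by
  refine T.isSmoothField_of_comp ?_
  have h : T.comp (mlieBracket I X Y) = fun x ↦ mvfderiv I (T.comp Y) x (X x) -
      mvfderiv I (T.comp X) x (Y x) + T.bracket (T.comp X x) (T.comp Y x) :=
    funext (T.comp_mlieBracket hX hY)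
  rw [h]
  exact ((T.contMDiff_mvfderiv_comp hX hY).sub (T.contMDiff_mvfderiv_comp hY hX)).add
    ((T.bracket.contMDiff.comp (T.contMDiff_comp hX)).clm_apply (T.contMDiff_comp hY))

lemma contMDiffCovariantDerivative_conn (Γ : V →L[ℝ] V →L[ℝ] V) :
    CovariantDerivative.ContMDiffCovariantDerivative (T.conn Γ) ∞ where
  contMDiff :=
    { contMDiff := by
        intro σ hσ
        rw [contMDiffOn_univ] at hσ ⊢
        have hσ' : IsSmoothField σ := hσ.of_le (by simp)
        -- The endomorphism field `∇σ` read in the framing. Its value on a fixed `v` is a derivative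
        -- along the smooth field with constant components `v`, plus a `Γ` term.
        let A : M → V →L[ℝ] V := fun x ↦
          (mvfderiv I (T.comp σ) x + (Γ.flip (T.comp σ x)).comp
            (T.coframe x : TangentSpace I x →L[ℝ] V)).comp
            ((T.coframe x).symm : V →L[ℝ] TangentSpace I x)
        have hA : ContMDiff I 𝓘(ℝ, V →L[ℝ] V) ∞ A := by
          intro x
          refine contMDiffAt_clm_of_apply fun v ↦ ?_
          have h1 := (T.contMDiff_mvfderiv_comp (T.isSmoothField_field v) hσ').add
            ((Γ v).contMDiff.comp (T.contMDiff_comp hσ'))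
          refine (h1 x).congr_of_eventuallyEq (Eventually.of_forall fun y ↦ ?_)
          simp [A, field]
        have h2 := T.contMDiff_endField hA
        convert h2 using 2 with x
        congr 1
        ext v
        simp [endField, A, conn] }

end Framing

/-! ### Hermitian linear algebra, and its transfer to a framed manifold. -/

section PositiveForm

variable {V : Type*} [NormedAddCommGroup V] [NormedSpace ℝ V] [FiniteDimensional ℝ V]

/-- The unit ball of a positive definite form on a finite-dimensional space is bounded. -/
lemma isBounded_ball_of_pos (B : V →L[ℝ] V →L[ℝ] ℝ) (hB : ∀ v, v ≠ 0 → 0 < B v v) :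
    Bornology.IsBounded {v : V | B v v < 1} := by
  obtain ⟨c, hc, hcB⟩ : ∃ c > 0, ∀ v : V, ‖v‖ = 1 → c ≤ B v v := by
    rcases (Metric.sphere (0 : V) 1).eq_empty_or_nonempty with h | h
    -- The sphere is empty only if `V` is trivial, and then any positive constant works; otherwise
    -- `c` is the minimum of the form on the compact unit sphere.
    · refine ⟨1, one_pos, fun v hv ↦ ?_⟩
      have : v ∈ Metric.sphere (0 : V) 1 := by simpa using hv
      rw [h] at this
      exact this.elim
    · have : ProperSpace V := FiniteDimensional.proper ℝ V
      obtain ⟨w, hw, hmin⟩ := (isCompact_sphere (0 : V) 1).exists_isMinOn h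
        (f := fun v ↦ B v v) (B.continuous.clm_apply continuous_id).continuousOn
      have hw1 : ‖w‖ = 1 := by simpa using hw
      refine ⟨B w w, hB w (by rintro rfl; simp at hw1), fun v hv ↦ ?_⟩
      exact hmin (by simpa using hv)
  refine (Metric.isBounded_iff_subset_closedBall 0).2 ⟨Real.sqrt (1 / c), fun v hv ↦ ?_⟩
  rw [mem_closedBall_zero_iff]
  by_cases hv0 : v = 0
  · simp [hv0]
  have hn : 0 < ‖v‖ := norm_pos_iff.2 hv0
  have h1 := hcB (‖v‖⁻¹ • v) (by rw [norm_smul, norm_inv, norm_norm, inv_mul_cancel₀ hn.ne'])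
  have h2 : B (‖v‖⁻¹ • v) (‖v‖⁻¹ • v) = B v v / ‖v‖ ^ 2 := by
    simp only [map_smul, smul_apply, smul_eq_mul]
    field_simp
  rw [h2, le_div_iff₀ (by positivity)] at h1
  refine Real.le_sqrt_of_sq_le ?_
  rw [le_div_iff₀ hc, mul_comm]
  exact h1.trans (le_of_lt hv)

end PositiveForm

/-- A Hermitian structure on a vector space. -/
structure LinearHermitian (V : Type*) [NormedAddCommGroup V] [NormedSpace ℝ V] where
  /-- The scalar product. -/
  inner : V →L[ℝ] V →L[ℝ] ℝ
  symm : ∀ u v, inner u v = inner v u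
  pos : ∀ v, v ≠ 0 → 0 < inner v v
  /-- The complex structure. -/
  J : V →L[ℝ] V
  J_sq : ∀ v, J (J v) = -v
  J_isometry : ∀ u v, inner (J u) (J v) = inner u v

namespace LinearHermitian

variable {V : Type*} [NormedAddCommGroup V] [NormedSpace ℝ V] (h : LinearHermitian V)
  (c : V →L[ℝ] V →L[ℝ] V)

lemma inner_J_left (u v : V) : h.inner (h.J u) v = -h.inner u (h.J v) := by
  rw [← h.J_isometry u (h.J v), h.J_sq]; simp

lemma inner_J_swap (u v : V) : h.inner (h.J u) v = -h.inner (h.J v) u := by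
  rw [h.inner_J_left, h.symm]

/-- The exterior derivative of the fundamental form, for the structure constants `c`. -/
def dFund (u v w : V) : ℝ :=
  -h.inner (h.J (c u v)) w + h.inner (h.J (c u w)) v - h.inner (h.J (c v w)) u

/-- The `(2,1)+(1,2)`-part of `dFund`. -/
def dFundPlus (u v w : V) : ℝ :=
  (1 / 4) * (3 * h.dFund c u v w + h.dFund c (h.J u) (h.J v) w
    + h.dFund c (h.J u) v (h.J w) + h.dFund c u (h.J v) (h.J w))

/-- The Nijenhuis tensor, for the structure constants `c`. -/
def nijenhuis (u v : V) : V :=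
  h.J (c (h.J u) v) + h.J (c u (h.J v)) + c u v - c (h.J u) (h.J v)

/-- The right-hand side of the equation for the torsion of the `t`-Gauduchon connection. -/
def gauduchonForm (t : ℝ) (u v w : V) : ℝ :=
  -(1 / 4) * h.inner (h.nijenhuis c u v) w
    + (1 - t / 2) * ((1 / 2) * (h.dFundPlus c u v (h.J w)
      - h.dFundPlus c (h.J u) (h.J v) (h.J w)))
    + (t / 2) * h.dFundPlus c (h.J u) (h.J v) (h.J w)

end LinearHermitian

namespace Framing

variable {E : Type*} [NormedAddCommGroup E] [NormedSpace ℝ E] [FiniteDimensional ℝ E]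
  {HM : Type*} [TopologicalSpace HM] {I : ModelWithCorners ℝ E HM}
  {M : Type*} [TopologicalSpace M] [ChartedSpace HM M] [IsManifold I ∞ M]
  {V : Type*} [NormedAddCommGroup V] [NormedSpace ℝ V] [FiniteDimensional ℝ V]
  (T : Framing I M V) (h : LinearHermitian V)

/-- The almost Hermitian structure with constant components in the framing. -/
def hermitian : AlmostHermitianStructure I M where
  g :=
    { inner := T.formField h.inner
      symm := fun x v w ↦ h.symm _ _
      pos := fun x v hv ↦ h.pos _ (by simpa using hv)
      isVonNBounded := fun x ↦ by
        have h1 : Bornology.IsVonNBounded ℝ {v : V | h.inner v v < 1} :=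
          NormedSpace.isVonNBounded_of_isBounded _ (isBounded_ball_of_pos h.inner h.pos)
        have h2 := h1.image ((T.coframe x).symm : V →L[ℝ] TangentSpace I x)
        have h3 : {v : TangentSpace I x | h.inner (T.coframe x v) (T.coframe x v) < 1} ⊆
            ((T.coframe x).symm : V →L[ℝ] TangentSpace I x) '' {v : V | h.inner v v < 1} :=
          fun v hv ↦ ⟨T.coframe x v, hv, by simp⟩
        exact Bornology.IsVonNBounded.subset h3 h2
      contMDiff := T.contMDiff_formField h.inner }
  J := T.endField (fun _ ↦ h.J)
  smooth_J := T.contMDiff_endField contMDiff_const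
  J_sq x v := by simp [endField, h.J_sq]
  J_isometry x u v := by simp [endField, formField_apply, h.J_isometry]

lemma hermitian_inner (x : M) (u v : TangentSpace I x) :
    (T.hermitian h).g.inner x u v = h.inner (T.coframe x u) (T.coframe x v) := rfl

lemma coframe_J (x : M) (u : TangentSpace I x) :
    T.coframe x ((T.hermitian h).J x u) = h.J (T.coframe x u) := by
  simp [hermitian, endField]

lemma comp_JField (X : VecField I M) :
    T.comp ((T.hermitian h).JField X) = fun x ↦ h.J (T.comp X x) :=
  funext fun x ↦ T.coframe_J h x (X x)

lemma isSmoothField_JField {X : VecField I M} (hX : IsSmoothField X) :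
    IsSmoothField ((T.hermitian h).JField X) := by
  refine T.isSmoothField_of_comp ?_
  rw [T.comp_JField h]
  exact h.J.contMDiff.comp (T.contMDiff_comp hX)

lemma mdifferentiableAt_comp_of_smooth {X : VecField I M} (hX : IsSmoothField X) (x : M) :
    MDifferentiableAt I 𝓘(ℝ, V) (T.comp X) x :=
  (T.contMDiff_comp hX).mdifferentiableAt (by simp)

lemma lieDeriv_inner {Y Z : VecField I M} (hY : IsSmoothField Y) (hZ : IsSmoothField Z)
    (X : VecField I M) (x : M) :
    lieDeriv X (fun y ↦ (T.hermitian h).g.inner y (Y y) (Z y)) x =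
      h.inner (mvfderiv I (T.comp Y) x (X x)) (T.comp Z x)
        + h.inner (T.comp Y x) (mvfderiv I (T.comp Z) x (X x)) :=
  mvfderiv_bilinear h.inner (T.mdifferentiableAt_comp_of_smooth hY x)
    (T.mdifferentiableAt_comp_of_smooth hZ x) (X x)

lemma mvfderiv_comp_JField {Y : VecField I M} (hY : IsSmoothField Y) (x : M)
    (v : TangentSpace I x) :
    mvfderiv I (T.comp ((T.hermitian h).JField Y)) x v = h.J (mvfderiv I (T.comp Y) x v) := by
  rw [comp_JField]
  exact mvfderiv_clm h.J (T.mdifferentiableAt_comp_of_smooth hY x) v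

lemma lieDeriv_fundForm {Y Z : VecField I M} (hY : IsSmoothField Y) (hZ : IsSmoothField Z)
    (X : VecField I M) (x : M) :
    lieDeriv X (fun y ↦ (T.hermitian h).fundForm y (Y y) (Z y)) x =
      h.inner (h.J (mvfderiv I (T.comp Y) x (X x))) (T.comp Z x)
        + h.inner (h.J (T.comp Y x)) (mvfderiv I (T.comp Z) x (X x)) := by
  rw [← T.mvfderiv_comp_JField h hY]
  have h1 := T.lieDeriv_inner h (T.isSmoothField_JField h hY) hZ X x
  rw [comp_JField] at h1 ⊢
  exact h1

lemma fundForm_eq (x : M) (u v : TangentSpace I x) :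
    (T.hermitian h).fundForm x u v = h.inner (h.J (T.coframe x u)) (T.coframe x v) := by
  unfold AlmostHermitianStructure.fundForm
  rw [hermitian_inner, coframe_J]

/-- The derivatives of components produced by the Lie derivatives cancel those produced by the
brackets, by skewness of `ω`; only the structure constants survive. -/
lemma dFund_eq {X Y Z : VecField I M} (hX : IsSmoothField X) (hY : IsSmoothField Y)
    (hZ : IsSmoothField Z) (x : M) :
    (T.hermitian h).dFund X Y Z x =
      h.dFund T.bracket (T.comp X x) (T.comp Y x) (T.comp Z x) := by
  unfold AlmostHermitianStructure.dFund extDerivTwo LinearHermitian.dFund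
  rw [T.lieDeriv_fundForm h hY hZ, T.lieDeriv_fundForm h hX hZ, T.lieDeriv_fundForm h hX hY]
  simp only [fundForm_eq, T.comp_mlieBracket hX hY, T.comp_mlieBracket hX hZ,
    T.comp_mlieBracket hY hZ, map_add, map_sub, add_apply, sub_apply]
  change _ + _ - (_ + _) + (_ + _) - (h.inner _ (T.comp Z x) - h.inner _ (T.comp Z x)
    + h.inner _ (T.comp Z x)) + (h.inner _ (T.comp Y x) - h.inner _ (T.comp Y x)
    + h.inner _ (T.comp Y x)) - (h.inner _ (T.comp X x) - h.inner _ (T.comp X x)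
    + h.inner _ (T.comp X x)) = _
  rw [h.inner_J_swap (T.comp Y x), h.inner_J_swap (T.comp X x), h.inner_J_swap (T.comp X x)]
  ring

lemma dFundPlus_eq {X Y Z : VecField I M} (hX : IsSmoothField X) (hY : IsSmoothField Y)
    (hZ : IsSmoothField Z) (x : M) :
    (T.hermitian h).dFundPlus X Y Z x =
      h.dFundPlus T.bracket (T.comp X x) (T.comp Y x) (T.comp Z x) := by
  have hJX := T.isSmoothField_JField h hX
  have hJY := T.isSmoothField_JField h hY
  have hJZ := T.isSmoothField_JField h hZ
  unfold AlmostHermitianStructure.dFundPlus LinearHermitian.dFundPlus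
  rw [T.dFund_eq h hX hY hZ, T.dFund_eq h hJX hJY hZ, T.dFund_eq h hJX hY hJZ,
    T.dFund_eq h hX hJY hJZ]
  simp only [comp_JField]

/-- `J` has constant components, so it commutes with differentiation of components, and the
derivative terms of the four brackets cancel through `J² = -1`. -/
lemma coframe_nijenhuis {X Y : VecField I M} (hX : IsSmoothField X) (hY : IsSmoothField Y)
    (x : M) :
    T.coframe x ((T.hermitian h).nijenhuis X Y x) =
      h.nijenhuis T.bracket (T.comp X x) (T.comp Y x) := by
  have hJX := T.isSmoothField_JField h hX
  have hJY := T.isSmoothField_JField h hY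
  unfold AlmostHermitianStructure.nijenhuis LinearHermitian.nijenhuis
  simp only [map_add, map_sub, coframe_J, T.comp_mlieBracket hJX hY, T.comp_mlieBracket hX hJY,
    T.comp_mlieBracket hX hY, T.comp_mlieBracket hJX hJY, T.mvfderiv_comp_JField h hX,
    T.mvfderiv_comp_JField h hY]
  simp only [comp_JField, h.J_sq]
  abel

lemma gauduchonForm_eq (t : ℝ) {X Y Z : VecField I M} (hX : IsSmoothField X)
    (hY : IsSmoothField Y) (hZ : IsSmoothField Z) (x : M) :
    -(1 / 4) * (T.hermitian h).g.inner x ((T.hermitian h).nijenhuis X Y x) (Z x)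
        + (1 - t / 2) * (T.hermitian h).thetaC X Y Z x + (t / 2) * (T.hermitian h).thetaB X Y Z x =
      h.gauduchonForm T.bracket t (T.comp X x) (T.comp Y x) (T.comp Z x) := by
  have hJX := T.isSmoothField_JField h hX
  have hJY := T.isSmoothField_JField h hY
  have hJZ := T.isSmoothField_JField h hZ
  unfold AlmostHermitianStructure.thetaC AlmostHermitianStructure.thetaB
    LinearHermitian.gauduchonForm
  rw [hermitian_inner, T.coframe_nijenhuis h hX hY, T.dFundPlus_eq h hX hY hJZ,
    T.dFundPlus_eq h hJX hJY hJZ]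
  simp only [comp_JField]
  rfl

lemma torsionForm_conn (Γ : V →L[ℝ] V →L[ℝ] V) (x : M) (u v w : TangentSpace I x) :
    (T.hermitian h).torsionForm (T.conn Γ) x u v w =
      h.inner (Γ (T.coframe x u) (T.coframe x v) - Γ (T.coframe x v) (T.coframe x u)
        - T.bracket (T.coframe x u) (T.coframe x v)) (T.coframe x w) := by
  unfold AlmostHermitianStructure.torsionForm
  rw [hermitian_inner, coframe_torsion]

/-- The connection `T.conn Γ` is the `t`-Gauduchon connection if `Γ` takes values in the unitary
Lie algebra and the torsion equation holds on constant fields. -/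
lemma isGauduchon_conn (t : ℝ) (Γ : V →L[ℝ] V →L[ℝ] V)
    (hskew : ∀ u v w, h.inner (Γ u v) w + h.inner v (Γ u w) = 0)
    (hJ : ∀ u v, Γ u (h.J v) = h.J (Γ u v))
    (htor : ∀ u v w, h.inner (Γ u v - Γ v u - T.bracket u v) w =
      h.gauduchonForm T.bracket t u v w) :
    (T.hermitian h).IsGauduchon t (T.conn Γ) where
  smooth := T.contMDiffCovariantDerivative_conn Γ
  metric X Y Z hX hY hZ x := by
    rw [T.lieDeriv_inner h hY hZ, hermitian_inner, hermitian_inner]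
    have h1 := T.comp_cov Γ X Y x
    have h2 := T.comp_cov Γ X Z x
    unfold comp at h1 h2
    rw [h1, h2, map_add, map_add, add_apply]
    have h3 := hskew (T.comp X x) (T.comp Y x) (T.comp Z x)
    unfold comp at h3 ⊢
    linarith
  complex X Y hX hY x := by
    apply (T.coframe x).injective
    rw [coframe_J]
    have h1 := T.comp_cov Γ X Y x
    have h2 := T.comp_cov Γ X ((T.hermitian h).JField Y) x
    rw [T.mvfderiv_comp_JField h hY, comp_JField, hJ, ← map_add, ← h1] at h2
    exact h2
  torsion_eq X Y Z hX hY hZ x := by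
    rw [T.gauduchonForm_eq h t hX hY hZ, torsionForm_conn]
    exact htor _ _ _

/-- The curvature of `T.conn Γ` vanishes when `Γ` is a representation. -/
lemma isFlat_conn [I.Boundaryless] (Γ : V →L[ℝ] V →L[ℝ] V)
    (hΓ : ∀ u v w, Γ (T.bracket u v) w = Γ u (Γ v w) - Γ v (Γ u w)) : IsFlat (T.conn Γ) := by
  intro X Y Z hX hY hZ x
  have : CompleteSpace E := FiniteDimensional.complete ℝ E
  apply (T.coframe x).injective
  rw [map_sub, map_sub, map_zero]
  have key : ∀ {X Y : VecField I M}, IsSmoothField X → IsSmoothField Y →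
      T.coframe x (cov (T.conn Γ) X (cov (T.conn Γ) Y Z) x) =
      mvfderiv I (fun y ↦ mvfderiv I (T.comp Z) y (Y y)) x (X x)
        + (Γ (mvfderiv I (T.comp Y) x (X x)) (T.comp Z x)
          + Γ (T.comp Y x) (mvfderiv I (T.comp Z) x (X x)))
        + Γ (T.comp X x) (mvfderiv I (T.comp Z) x (Y x) + Γ (T.comp Y x) (T.comp Z x)) := by
    intro X Y hX hY
    have h1 := T.comp_cov Γ X (cov (T.conn Γ) Y Z) x
    have h2 : T.comp (cov (T.conn Γ) Y Z) = fun y ↦ mvfderiv I (T.comp Z) y (Y y)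
        + Γ (T.comp Y y) (T.comp Z y) := funext (T.comp_cov Γ Y Z)
    rw [h2, mvfderiv_fun_add, add_apply, mvfderiv_bilinear Γ
      (T.mdifferentiableAt_comp_of_smooth hY x) (T.mdifferentiableAt_comp_of_smooth hZ x)] at h1
    · exact h1
    · exact (T.contMDiff_mvfderiv_comp hY hZ).mdifferentiableAt (by simp)
    · exact ((Γ.contMDiff.comp (T.contMDiff_comp hY)).clm_apply
        (T.contMDiff_comp hZ)).mdifferentiableAt (by simp)
  have h3 : T.coframe x (cov (T.conn Γ) (mlieBracket I X Y) Z x) = _ :=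
    T.comp_cov Γ (mlieBracket I X Y) Z x
  have h4 : T.comp (mlieBracket I X Y) x = _ := T.comp_mlieBracket hX hY x
  -- The second derivatives of the components of `Z` cancel by the commutator formula; the terms
  -- quadratic in `Γ` cancel by the representation property.
  have h5 := mvfderiv_mlieBracket (f := T.comp Z)
    (((T.contMDiff_comp hZ) x).of_le (by norm_cast)) (hX.mdifferentiableAt x)
    (hY.mdifferentiableAt x)
  rw [key hX hY, key hY hX, h3, h4, h5]
  simp only [map_add, map_sub, add_apply, sub_apply, hΓ]
  abel

end Framing

/-! ### Uniqueness of the Gauduchon connection. -/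

section Uniqueness

variable {E : Type*} [NormedAddCommGroup E] [NormedSpace ℝ E] [FiniteDimensional ℝ E]
  {HM : Type*} [TopologicalSpace HM] {I : ModelWithCorners ℝ E HM}
  {M : Type*} [TopologicalSpace M] [ChartedSpace HM M] [IsManifold I ∞ M]
  {V : Type*} [NormedAddCommGroup V] [NormedSpace ℝ V] [FiniteDimensional ℝ V]

/-- A metric connection is determined by its torsion. -/
lemma AlmostHermitianStructure.IsGauduchon.cov_unique (T : Framing I M V)
    {S : AlmostHermitianStructure I M} {t : ℝ}
    {D D' : CovariantDerivative I E (fun x : M ↦ TangentSpace I x)}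
    (hD : S.IsGauduchon t D) (hD' : S.IsGauduchon t D') {X Y : VecField I M}
    (hX : IsSmoothField X) (hY : IsSmoothField Y) : cov D X Y = cov D' X Y := by
  funext x
  -- The difference of the two connections is skew in the last two arguments (both are metric) and
  -- symmetric in the first two (equal torsions). Alternating the two symmetries six times gives `δ
  -- = -δ`.
  let δ : VecField I M → VecField I M → VecField I M → ℝ := fun X Y Z ↦
    S.g.inner x (cov D X Y x - cov D' X Y x) (Z x)
  have hsk : ∀ {X Y Z : VecField I M}, IsSmoothField X → IsSmoothField Y → IsSmoothField Z →
      δ X Y Z = -δ X Z Y := by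
    intro X Y Z hX hY hZ
    have h1 := hD.metric X Y Z hX hY hZ x
    have h2 := hD'.metric X Y Z hX hY hZ x
    simp only [δ, map_sub, sub_apply]
    rw [S.g.symm x (Y x)] at h1 h2
    linarith
  have hsy : ∀ {X Y Z : VecField I M}, IsSmoothField X → IsSmoothField Y → IsSmoothField Z →
      δ X Y Z = δ Y X Z := by
    intro X Y Z hX hY hZ
    have h1 := (hD.torsion_eq X Y Z hX hY hZ x).trans (hD'.torsion_eq X Y Z hX hY hZ x).symm
    unfold AlmostHermitianStructure.torsionForm at h1
    rw [D.torsion_apply (hX.mdifferentiableAt x) (hY.mdifferentiableAt x),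
      D'.torsion_apply (hX.mdifferentiableAt x) (hY.mdifferentiableAt x)] at h1
    simp only [map_sub, sub_apply, δ, cov] at h1 ⊢
    linarith
  have hzero : ∀ {Z : VecField I M}, IsSmoothField Z → δ X Y Z = 0 := by
    intro Z hZ
    have e1 := hsk hX hY hZ
    have e2 := hsy hX hZ hY
    have e3 := hsk hZ hX hY
    have e4 := hsy hZ hY hX
    have e5 := hsk hY hZ hX
    have e6 := hsy hY hX hZ
    linarith
  by_contra hne
  set w := cov D X Y x - cov D' X Y x with hw
  have hpos := S.g.pos x w (sub_ne_zero.2 hne)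
  have h0 := hzero (T.isSmoothField_field (T.coframe x w))
  have hfw : T.field (T.coframe x w) x = w := by simp [Framing.field]
  simp only [δ, hfw] at h0
  exact hpos.ne' h0

/-- The torsion equation constrains smooth fields, whereas the torsion form takes tangent vectors;
the framing extends each vector to a smooth field. -/
lemma AlmostHermitianStructure.IsGauduchon.torsionForm_unique (T : Framing I M V)
    {S : AlmostHermitianStructure I M} {t : ℝ}
    {D D' : CovariantDerivative I E (fun x : M ↦ TangentSpace I x)}
    (hD : S.IsGauduchon t D) (hD' : S.IsGauduchon t D') : S.torsionForm D = S.torsionForm D' := by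
  funext x u v w
  have h := (hD.torsion_eq _ _ _ (T.isSmoothField_field (T.coframe x u))
    (T.isSmoothField_field (T.coframe x v)) (T.isSmoothField_field (T.coframe x w)) x).trans
    (hD'.torsion_eq _ _ _ (T.isSmoothField_field (T.coframe x u))
    (T.isSmoothField_field (T.coframe x v)) (T.isSmoothField_field (T.coframe x w)) x).symm
  simpa [Framing.field] using h

/-- Uniqueness compares the connections on smooth fields only, so the curvature can be transferred
because `∇_Y Z` for the model connection and `[X, Y]` are again smooth. -/
lemma AlmostHermitianStructure.IsGauduchon.isFlat_of_isFlat (T : Framing I M V)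
    {S : AlmostHermitianStructure I M} {t : ℝ} {Γ : V →L[ℝ] V →L[ℝ] V}
    {D : CovariantDerivative I E (fun x : M ↦ TangentSpace I x)}
    (hD : S.IsGauduchon t D) (hD' : S.IsGauduchon t (T.conn Γ)) (hflat : IsFlat (T.conn Γ)) :
    IsFlat D := by
  intro X Y Z hX hY hZ x
  rw [hD.cov_unique T hD' hX hZ, hD.cov_unique T hD' hY hZ,
    hD.cov_unique T hD' hX (T.isSmoothField_cov Γ hY hZ),
    hD.cov_unique T hD' hY (T.isSmoothField_cov Γ hX hZ),
    hD.cov_unique T hD' (T.isSmoothField_mlieBracket hX hY) hZ]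
  exact hflat X Y Z hX hY hZ x

end Uniqueness

/-! ### Closedness of the Cartan 3-form of an invariant scalar product. -/

namespace Framing

variable {E : Type*} [NormedAddCommGroup E] [NormedSpace ℝ E] [FiniteDimensional ℝ E]
  {HM : Type*} [TopologicalSpace HM] {I : ModelWithCorners ℝ E HM}
  {M : Type*} [TopologicalSpace M] [ChartedSpace HM M] [IsManifold I ∞ M]
  {V : Type*} [NormedAddCommGroup V] [NormedSpace ℝ V] [FiniteDimensional ℝ V]
  (T : Framing I M V) (h : LinearHermitian V)

/-- The three-form of an invariant scalar product is closed. -/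
lemma isClosedThree_bracket (hskew : ∀ u v, T.bracket u v = -T.bracket v u)
    (hinv : ∀ u v w, h.inner (T.bracket u v) w = h.inner u (T.bracket v w))
    (hjac : ∀ u v w, T.bracket u (T.bracket v w) =
      T.bracket (T.bracket u v) w + T.bracket v (T.bracket u w)) :
    IsClosedThree (I := I) (M := M) (fun x u v w ↦
      h.inner (-T.bracket (T.coframe x u) (T.coframe x v)) (T.coframe x w)) := by
  intro W X Y Z hW hX hY hZ x
  have key : ∀ {P Q R : VecField I M}, IsSmoothField P → IsSmoothField Q → IsSmoothField R →
      ∀ U : VecField I M,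
      lieDeriv U (fun y ↦
        h.inner (-T.bracket (T.coframe y (P y)) (T.coframe y (Q y))) (T.coframe y (R y))) x =
      -(h.inner (T.bracket (mvfderiv I (T.comp P) x (U x)) (T.comp Q x)) (T.comp R x)
        + h.inner (T.bracket (T.comp P x) (mvfderiv I (T.comp Q) x (U x))) (T.comp R x)
        + h.inner (T.bracket (T.comp P x) (T.comp Q x)) (mvfderiv I (T.comp R) x (U x))) := by
    intro P Q R hP hQ hR U
    have hPd := T.mdifferentiableAt_comp_of_smooth hP x
    have hQd := T.mdifferentiableAt_comp_of_smooth hQ x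
    have hRd := T.mdifferentiableAt_comp_of_smooth hR x
    have h1 : MDifferentiableAt I 𝓘(ℝ, V) (fun y ↦ (-T.bracket) (T.comp P y) (T.comp Q y)) x :=
      (((-T.bracket).contMDiff.comp (T.contMDiff_comp hP)).clm_apply
        (T.contMDiff_comp hQ)).mdifferentiableAt (by simp)
    have h2 := mvfderiv_bilinear h.inner h1 hRd (U x)
    rw [mvfderiv_bilinear (-T.bracket) hPd hQd] at h2
    refine (show _ = _ from h2).trans ?_
    simp only [neg_apply, map_neg, map_add, add_apply]
    ring
  have s1 : ∀ u v w, h.inner (T.bracket u v) w = -h.inner (T.bracket v u) w := by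
    intro u v w; rw [hskew]; simp
  have s2 : ∀ u v w, h.inner (T.bracket u v) w = h.inner (T.bracket v w) u := by
    intro u v w; rw [hinv, h.symm]
  have hj : h.inner (T.bracket (T.bracket (T.comp W x) (T.comp X x)) (T.comp Y x)) (T.comp Z x)
      - h.inner (T.bracket (T.bracket (T.comp W x) (T.comp Y x)) (T.comp X x)) (T.comp Z x)
      + h.inner (T.bracket (T.bracket (T.comp W x) (T.comp Z x)) (T.comp X x)) (T.comp Y x) = 0 := by
    have hj' := hjac (T.comp X x) (T.comp Y x) (T.comp Z x)
    have hj2 := congrArg (h.inner (T.comp W x)) hj'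
    rw [map_add, hskew (T.bracket (T.comp X x) (T.comp Y x))] at hj2
    simp only [hinv]
    simp only [map_neg] at hj2
    linarith
  -- Both sides equal `⟨[a, b], [c, d]⟩` up to symmetry. This identifies the six constant terms of
  -- `dβ` in pairs, leaving twice the Jacobi sum `hj`.
  have q : ∀ a b c d, h.inner (T.bracket (T.bracket a b) c) d =
      h.inner (T.bracket (T.bracket c d) a) b := by
    intro a b c d
    rw [hinv, h.symm, ← hinv]
  unfold extDerivThree
  rw [key hX hY hZ W, key hW hY hZ X, key hW hX hZ Y, key hW hX hY Z]
  simp only [T.comp_mlieBracket hW hX, T.comp_mlieBracket hW hY, T.comp_mlieBracket hW hZ,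
    T.comp_mlieBracket hX hY, T.comp_mlieBracket hX hZ, T.comp_mlieBracket hY hZ]
  simp only [map_add, map_sub, add_apply, sub_apply, map_neg, neg_apply]
  simp only [← show ∀ X : VecField I M, T.comp X x = T.coframe x (X x) from fun _ ↦ rfl]
  generalize T.comp W x = w at *
  generalize T.comp X x = a at *
  generalize T.comp Y x = b at *
  generalize T.comp Z x = c at *
  have q1 := q a b w c
  have q2 := q a c w b
  have q3 := q b c w a
  have r1 : ∀ A u v, h.inner (T.bracket u A) v = -h.inner (T.bracket A u) v := fun A u v ↦ s1 u A v
  have r2 : ∀ A u v, h.inner (T.bracket u v) A = h.inner (T.bracket A u) v := fun A u v ↦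
    (s2 A u v).symm
  -- Moving each differentiated component into the first slot of the bracket makes the derivative
  -- terms match those coming from the Lie brackets.
  rw [r1 (mvfderiv I (T.comp Y) x (W x)), r2 (mvfderiv I (T.comp Z) x (W x)),
    r1 (mvfderiv I (T.comp Y) x (X x)), r2 (mvfderiv I (T.comp Z) x (X x)),
    r1 (mvfderiv I (T.comp X) x (Y x)), r2 (mvfderiv I (T.comp Z) x (Y x)),
    r1 (mvfderiv I (T.comp X) x (Z x)), r2 (mvfderiv I (T.comp Y) x (Z x))]
  linear_combination 2 * hj + q1 - q2 + q3

end Framing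

/-! ### Translations on a Lie group; left- and right-invariant fields commute. -/

section Translations

variable {E : Type*} [NormedAddCommGroup E] [NormedSpace ℝ E]
  {HM : Type*} [TopologicalSpace HM] {I : ModelWithCorners ℝ E HM}
  {G : Type*} [TopologicalSpace G] [ChartedSpace HM G] [Group G]

variable (I) in
/-- The differential at `y` of the left translation by `x`. -/
def leftD (x y : G) : E →L[ℝ] E := mfderiv I I (fun z ↦ x * z) y

variable (I) in
/-- The differential at `y` of the right translation by `x`. -/
def rightD (x y : G) : E →L[ℝ] E := mfderiv I I (fun z ↦ z * x) y

/-- The right invariant field with value `u` at the identity. -/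
def rightField (u : E) : VecField I G := fun x ↦ rightD I x 1 u

/-- The left invariant field with value `u` at the identity. -/
def leftField (u : E) : VecField I G := fun x ↦ leftD I x 1 u

lemma leftField_eq (u : GroupLieAlgebra I G) :
    (leftField (u : E) : VecField I G) = mulInvariantVectorField u := rfl

lemma leftD_one (y : G) : leftD I 1 y = ContinuousLinearMap.id ℝ E := by
  have h : (fun z : G ↦ 1 * z) = id := by ext z; simp
  unfold leftD
  rw [h]
  exact mfderiv_id

lemma rightD_one (y : G) : rightD I 1 y = ContinuousLinearMap.id ℝ E := by
  have h : (fun z : G ↦ z * 1) = id := by ext z; simp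
  unfold rightD
  rw [h]
  exact mfderiv_id

variable [LieGroup I ∞ G]

/-- The regularity under which `GroupLieAlgebra` carries its Lie algebra structure. -/
instance instLieGroupMinSmoothness : LieGroup I (minSmoothness ℝ 3) G :=
  LieGroup.of_le (n := ∞) (by rw [minSmoothness_of_isRCLikeNormedField]; norm_cast)

lemma mdifferentiableAt_mul_left (x y : G) : MDifferentiableAt I I (fun z : G ↦ x * z) y :=
  (contMDiff_mul_left (I := I) (n := ∞)).mdifferentiableAt (by simp)

lemma mdifferentiableAt_mul_right (x y : G) : MDifferentiableAt I I (fun z : G ↦ z * x) y :=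
  (contMDiff_mul_right (I := I) (n := ∞)).mdifferentiableAt (by simp)

lemma leftD_leftD (x y z : G) (u : E) : leftD I x (y * z) (leftD I y z u) = leftD I (x * y) z u := by
  have h : (fun w : G ↦ x * y * w) = (fun w ↦ x * w) ∘ (fun w ↦ y * w) := by ext w; simp [mul_assoc]
  unfold leftD
  rw [h]
  exact (congrArg (fun L : E →L[ℝ] E ↦ L u) (mfderiv_comp (I' := I) z
    (mdifferentiableAt_mul_left x (y * z)) (mdifferentiableAt_mul_left y z))).symm

lemma rightD_rightD (x y z : G) (u : E) :
    rightD I x (z * y) (rightD I y z u) = rightD I (y * x) z u := by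
  have h : (fun w : G ↦ w * (y * x)) = (fun w ↦ w * x) ∘ (fun w ↦ w * y) := by
    ext w; simp [mul_assoc]
  unfold rightD
  rw [h]
  exact (congrArg (fun L : E →L[ℝ] E ↦ L u) (mfderiv_comp (I' := I) z
    (mdifferentiableAt_mul_right x (z * y)) (mdifferentiableAt_mul_right y z))).symm

lemma leftD_rightD (x y z : G) (u : E) :
    leftD I x (z * y) (rightD I y z u) = rightD I y (x * z) (leftD I x z u) := by
  have h : (fun w : G ↦ x * w) ∘ (fun w ↦ w * y) = (fun w ↦ w * y) ∘ (fun w ↦ x * w) := by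
    ext w; simp [mul_assoc]
  have h1 := congrArg (fun L : E →L[ℝ] E ↦ L u) (mfderiv_comp (I' := I) z
    (mdifferentiableAt_mul_left x (z * y)) (mdifferentiableAt_mul_right y z))
  have h2 := congrArg (fun L : E →L[ℝ] E ↦ L u) (mfderiv_comp (I' := I) z
    (mdifferentiableAt_mul_right y (x * z)) (mdifferentiableAt_mul_left x z))
  rw [h] at h1
  exact h1.symm.trans h2

lemma leftD_inv_left (x y : G) (u : E) : leftD I x⁻¹ (x * y) (leftD I x y u) = u := by
  rw [leftD_leftD, inv_mul_cancel, leftD_one]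
  rfl

lemma leftD_inv_right (x y : G) (u : E) : leftD I x y (leftD I x⁻¹ (x * y) u) = u := by
  have h := leftD_leftD (I := I) x x⁻¹ (x * y) u
  rw [inv_mul_cancel_left, mul_inv_cancel, leftD_one] at h
  exact h

lemma leftD_leftField (x y : G) (u : E) :
    leftD I x y (leftField (I := I) u y) = leftField (I := I) u (x * y) := by
  have h := leftD_leftD (I := I) x y 1 u
  rwa [mul_one] at h

lemma rightD_rightField (x y : G) (u : E) :
    rightD I x y (rightField (I := I) u y) = rightField (I := I) u (y * x) := by
  have h := rightD_rightD (I := I) x y 1 u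
  rwa [one_mul] at h

lemma mfderiv_mul (p : G × G) (v : TangentSpace (I.prod I) p) :
    mfderiv (I.prod I) I (fun p : G × G ↦ p.1 * p.2) p v =
      (rightD I p.2 p.1 v.1 + leftD I p.1 p.2 v.2 : E) :=
  mfderiv_prod_eq_add_apply ((contMDiff_mul I ∞).mdifferentiableAt (by simp))

/-- The product of two smooth fields is smooth. -/
lemma IsSmoothField.prod {E' : Type*} [NormedAddCommGroup E'] [NormedSpace ℝ E']
    {HM' : Type*} [TopologicalSpace HM'] {I' : ModelWithCorners ℝ E' HM'}
    {M : Type*} [TopologicalSpace M] [ChartedSpace HM M] [IsManifold I ∞ M]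
    {M' : Type*} [TopologicalSpace M'] [ChartedSpace HM' M'] [IsManifold I' ∞ M']
    {X : VecField I M} {Y : VecField I' M'} (hX : IsSmoothField X) (hY : IsSmoothField Y) :
    IsSmoothField (I := I.prod I') (M := M × M') (fun p ↦ ((X p.1, Y p.2) : E × E')) := by
  have h : ContMDiff (I.prod I') ((I.prod 𝓘(ℝ, E)).prod (I'.prod 𝓘(ℝ, E'))) ∞
      (fun p : M × M' ↦ ((Bundle.TotalSpace.mk' E p.1 (X p.1) : TangentBundle I M),
        (Bundle.TotalSpace.mk' E' p.2 (Y p.2) : TangentBundle I' M'))) :=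
    ContMDiff.prodMap hX hY
  exact contMDiff_equivTangentBundleProd_symm.comp h

lemma isSmoothField_zero {M : Type*} [TopologicalSpace M] [ChartedSpace HM M] [IsManifold I ∞ M] :
    IsSmoothField (I := I) (M := M) (fun _ ↦ (0 : E)) :=
  Bundle.contMDiff_zeroSection _ _

/-- An invariant field is the tangent map of multiplication applied to a zero vector in one factor
and a fixed vector at the identity in the other; this is the source of its smoothness. -/
lemma isSmoothField_of_tangentMap_mul {f : G → TangentBundle I G × TangentBundle I G}
    (hf : ContMDiff I ((I.prod 𝓘(ℝ, E)).prod (I.prod 𝓘(ℝ, E))) ∞ f) :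
    ContMDiff I (I.prod 𝓘(ℝ, E)) ∞ (fun x ↦ tangentMap (I.prod I) I
      (fun p : G × G ↦ p.1 * p.2) ((equivTangentBundleProd I G I G).symm (f x))) :=
  (((contMDiff_mul I ∞).contMDiff_tangentMap (m := ∞) le_rfl).comp
    contMDiff_equivTangentBundleProd_symm).comp hf

lemma isSmoothField_leftField (u : E) : IsSmoothField (leftField u : VecField I G) := by
  have h := isSmoothField_of_tangentMap_mul (I := I)
    (f := fun x : G ↦ (Bundle.TotalSpace.mk' E x (0 : E), Bundle.TotalSpace.mk' E 1 u))
    ((isSmoothField_zero (I := I) (M := G)).prodMk contMDiff_const)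
  unfold IsSmoothField
  convert h using 2 with x
  · refine Bundle.TotalSpace.ext (by simp [tangentMap]) (heq_of_eq ?_)
    refine Eq.trans ?_ (mfderiv_mul (I := I) ((x, 1) : G × G) ((0, u) : E × E)).symm
    simp [leftField]
    rfl

lemma isSmoothField_rightField (u : E) : IsSmoothField (rightField u : VecField I G) := by
  have h := isSmoothField_of_tangentMap_mul (I := I)
    (f := fun x : G ↦ (Bundle.TotalSpace.mk' E 1 u, Bundle.TotalSpace.mk' E x (0 : E)))
    (contMDiff_const.prodMk (isSmoothField_zero (I := I) (M := G)))
  unfold IsSmoothField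
  convert h using 2 with x
  · refine Bundle.TotalSpace.ext (by simp [tangentMap]) (heq_of_eq ?_)
    refine Eq.trans ?_ (mfderiv_mul (I := I) ((1, x) : G × G) ((u, 0) : E × E)).symm
    simp [rightField]
    rfl

variable [FiniteDimensional ℝ E] [I.Boundaryless]

/-- Left and right invariant fields commute. -/
lemma mlieBracket_leftField_rightField (u v : E) (x : G) :
    mlieBracket I (leftField u) (rightField v) x = 0 := by
  have : CompleteSpace E := FiniteDimensional.complete ℝ E
  -- On `G × G` these two fields live on different factors, so both projections kill their bracket.
  -- Multiplication relates them to the left and right invariant fields on `G`, whose bracket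
  -- therefore vanishes too.
  let X : VecField (I.prod I) (G × G) := fun p ↦ ((0, leftField (I := I) u p.2) : E × E)
  let Y : VecField (I.prod I) (G × G) := fun p ↦ ((rightField (I := I) v p.1, 0) : E × E)
  have hL := isSmoothField_leftField (I := I) (G := G) u
  have hR := isSmoothField_rightField (I := I) (G := G) v
  have h0 := isSmoothField_zero (I := I) (M := G)
  have hX : IsSmoothField X := h0.prod hL
  have hY : IsSmoothField Y := hR.prod h0
  have h1 := mfderiv_mlieBracket_of_related (φ := fun p : G × G ↦ p.1 * p.2)
    (contMDiff_mul I ∞) hX hY hL hR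
    (fun p ↦ (mfderiv_mul p _).trans ((congrArg₂ (fun a b : E ↦ a + b)
      (map_zero (rightD I p.2 p.1)) (leftD_leftField p.1 p.2 u)).trans (zero_add _)))
    (fun p ↦ (mfderiv_mul p _).trans ((congrArg₂ (fun a b : E ↦ a + b)
      (rightD_rightField p.2 p.1 v) (map_zero (leftD I p.1 p.2))).trans (add_zero _))) (x, 1)
  have h2 := mfderiv_mlieBracket_of_related (φ := (Prod.fst : G × G → G)) contMDiff_fst hX hY h0 hR
    (fun p ↦ by rw [mfderiv_fst]; rfl) (fun p ↦ by rw [mfderiv_fst]; rfl) (x, 1)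
  have h3 := mfderiv_mlieBracket_of_related (φ := (Prod.snd : G × G → G)) contMDiff_snd hX hY hL h0
    (fun p ↦ by rw [mfderiv_snd]; rfl) (fun p ↦ by rw [mfderiv_snd]; rfl) (x, 1)
  rw [mfderiv_fst] at h2
  rw [mfderiv_snd] at h3
  have h2' : (mlieBracket (I.prod I) X Y ((x, 1) : G × G) : E × E).1 = 0 :=
    h2.trans (congrFun (mlieBracket_zero_left (W := rightField v)) x)
  have h3' : (mlieBracket (I.prod I) X Y ((x, 1) : G × G) : E × E).2 = 0 :=
    h3.trans (congrFun (mlieBracket_zero_right (W := leftField u)) 1)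
  have h4 : mlieBracket (I.prod I) X Y ((x, 1) : G × G) = 0 := Prod.ext h2' h3'
  rw [h4, map_zero] at h1
  exact (congrArg (fun y ↦ (mlieBracket I (leftField u) (rightField v) y : E))
    (mul_one x)).symm.trans h1.symm

end Translations

/-- A framing composed with a linear change of coordinates. -/
def Framing.trans {E : Type*} [NormedAddCommGroup E] [NormedSpace ℝ E]
    {HM : Type*} [TopologicalSpace HM] {I : ModelWithCorners ℝ E HM}
    {M : Type*} [TopologicalSpace M] [ChartedSpace HM M] [IsManifold I ∞ M]
    {V V' : Type*} [NormedAddCommGroup V] [NormedSpace ℝ V]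
    [NormedAddCommGroup V'] [NormedSpace ℝ V'] (T : Framing I M V) (ψ : V ≃L[ℝ] V') :
    Framing I M V' where
  coframe x := (T.coframe x).trans ψ
  smooth_symm v := T.smooth_symm (ψ.symm v)
  bracket := ((ContinuousLinearMap.precomp V' (ψ.symm : V' →L[ℝ] V)).comp
    ((ContinuousLinearMap.postcomp V (ψ : V →L[ℝ] V')).comp T.bracket)).comp
    (ψ.symm : V' →L[ℝ] V)
  mlieBracket_eq u v x := by
    simpa using T.mlieBracket_eq (ψ.symm u) (ψ.symm v) x

/-! ### The left-invariant framing and the derivative of the adjoint action. -/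

section LeftInvariant

variable {E : Type*} [NormedAddCommGroup E] [NormedSpace ℝ E] [FiniteDimensional ℝ E]
  {HM : Type*} [TopologicalSpace HM] {I : ModelWithCorners ℝ E HM} [I.Boundaryless]
  {G : Type*} [TopologicalSpace G] [ChartedSpace HM G] [Group G] [LieGroup I ∞ G]

instance instCompleteSpaceModel : CompleteSpace E := FiniteDimensional.complete ℝ E

variable (I G) in
/-- The Lie bracket of the Lie algebra of `G`, on the model space. -/
def lieBracketL : E →L[ℝ] E →L[ℝ] E :=
  LinearMap.toContinuousBilinearMap (LinearMap.mk₂ ℝ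
    (fun u v : E ↦ (Bracket.bracket (L := GroupLieAlgebra I G) (M := GroupLieAlgebra I G) u v : E))
    (fun u v w ↦ add_lie (L := GroupLieAlgebra I G) (M := GroupLieAlgebra I G) u v w)
    (fun c v w ↦ smul_lie (L := GroupLieAlgebra I G) (M := GroupLieAlgebra I G) c v w)
    (fun u v w ↦ lie_add (L := GroupLieAlgebra I G) (M := GroupLieAlgebra I G) u v w)
    (fun c v w ↦ lie_smul (L := GroupLieAlgebra I G) (M := GroupLieAlgebra I G) c v w))

lemma lieBracketL_skew (u v : E) : lieBracketL I G u v = -lieBracketL I G v u :=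
  (lie_skew (L := GroupLieAlgebra I G) u v).symm

lemma lieBracketL_jacobi (u v w : E) : lieBracketL I G u (lieBracketL I G v w) =
    lieBracketL I G (lieBracketL I G u v) w + lieBracketL I G v (lieBracketL I G u w) :=
  leibniz_lie (L₁ := GroupLieAlgebra I G) (L₂ := GroupLieAlgebra I G)
    (M := GroupLieAlgebra I G) u v w

lemma leftD_inv_self_left (x : G) (u : E) : leftD I x⁻¹ x (leftD I x 1 u) = u := by
  have h := leftD_inv_left (I := I) x 1 u
  rwa [mul_one] at h

lemma leftD_inv_self_right (x : G) (u : E) : leftD I x 1 (leftD I x⁻¹ x u) = u := by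
  have h := leftD_inv_right (I := I) x 1 u
  rwa [mul_one] at h

variable (I) in
/-- The left trivialization of the tangent bundle of `G`. -/
def leftEquiv (x : G) : TangentSpace I x ≃L[ℝ] E :=
  ContinuousLinearEquiv.equivOfInverse (M₁ := E) (M₂ := E) (leftD I x⁻¹ x) (leftD I x 1)
    (leftD_inv_self_right x) (leftD_inv_self_left x)

variable (I G) in
/-- The framing of a Lie group by left invariant fields. -/
def leftFraming : Framing I G E where
  coframe := leftEquiv I
  smooth_symm v := isSmoothField_leftField v
  bracket := lieBracketL I G
  mlieBracket_eq u v x := congrFun (mulInvariantVector_mlieBracket (I := I) (G := G) u v).symm x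

lemma leftFraming_coframe (x : G) (u : E) : (leftFraming I G).coframe x u = leftD I x⁻¹ x u := rfl

lemma leftEquiv_leftD (x y : G) (u : E) : leftEquiv I (x * y) (leftD I x y u) = leftEquiv I y u := by
  refine (leftD_leftD (I := I) (x * y)⁻¹ x y u).trans ?_
  rw [mul_inv_rev, inv_mul_cancel_right]
  rfl

variable (I) in
/-- The adjoint action of `x⁻¹`. -/
def adInv (x : G) (u : E) : E := leftEquiv I x (rightField (I := I) u x)

lemma adInv_eq (x : G) (u : E) : adInv I x u = leftD I x⁻¹ x (rightD I x 1 u) := rfl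

lemma adInv_one (u : E) : adInv I (1 : G) u = u := by
  rw [adInv_eq, inv_one, leftD_one, rightD_one]
  rfl

lemma adInv_add (x : G) (u v : E) : adInv I x (u + v) = adInv I x u + adInv I x v := by
  simp only [adInv_eq, map_add]

lemma adInv_smul (x : G) (c : ℝ) (u : E) : adInv I x (c • u) = c • adInv I x u := by
  simp only [adInv_eq, map_smul]

/-- Left and right translations commute. The order of the product matches left invariance of Haar
measure in the averaging argument. -/
lemma adInv_adInv (x y : G) (u : E) : adInv I y (adInv I x u) = adInv I (x * y) u := by
  have h1 := leftD_rightD (I := I) x⁻¹ y x (rightD I x 1 u)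
  rw [inv_mul_cancel] at h1
  have h2 := rightD_rightD (I := I) y x 1 u
  rw [one_mul] at h2
  simp only [adInv_eq]
  rw [← h1, h2]
  have h3 := leftD_leftD (I := I) y⁻¹ x⁻¹ (x * y) (rightD I (x * y) 1 u)
  rw [inv_mul_cancel_left, ← mul_inv_rev] at h3
  exact h3

lemma contMDiff_adInv (u : E) : ContMDiff I 𝓘(ℝ, E) ∞ (fun x : G ↦ adInv I x u) :=
  (leftFraming I G).contMDiff_comp (isSmoothField_rightField u)

/-- In the left framing a left-invariant field has constant components and the right-invariant field
of `u` has components `Ad(x⁻¹) u`. Since the two fields commute, the component formula for their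
bracket reads `0 = d(Ad(x⁻¹) u)(w) + [w, u]` at the identity. -/
lemma mvfderiv_adInv_one (u w : E) :
    mvfderiv I (fun x : G ↦ adInv I x u) 1 w = -lieBracketL I G w u := by
  have h := (leftFraming I G).comp_mlieBracket (isSmoothField_leftField (I := I) (G := G) w)
    (isSmoothField_rightField u) 1
  rw [mlieBracket_leftField_rightField, map_zero] at h
  have h1 : (leftFraming I G).comp (leftField (I := I) w) = fun _ ↦ w :=
    (leftFraming I G).comp_field w
  have h2 : (leftFraming I G).comp (rightField u) = fun x ↦ adInv I x u := rfl
  have h3 : (leftField (I := I) w (1 : G) : E) = w := by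
    show leftD I 1 1 w = w
    rw [leftD_one]; rfl
  rw [h1, h2, mvfderiv_const] at h
  have h4 : adInv I (1 : G) u = u := adInv_one u
  have h5 : (0 : E) = mvfderiv I (fun x : G ↦ adInv I x u) 1 w + lieBracketL I G w u := by
    refine h.trans ?_
    refine congrArg₂ (fun a b : E ↦ a + b) ?_ (congrArg (lieBracketL I G w) h4)
    refine (sub_zero _).trans ?_
    exact congrArg (fun z : E ↦ (mvfderiv I (fun x : G ↦ adInv I x u) 1 : E →L[ℝ] E) z) h3
  exact eq_neg_of_add_eq_zero_left h5.symm

/-- A form invariant under the adjoint action is invariant under its differential. -/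
lemma invariant_of_adInv (B : E →L[ℝ] E →L[ℝ] ℝ)
    (hB : ∀ (x : G) u v, B (adInv I x u) (adInv I x v) = B u v) (u v w : E) :
    B (lieBracketL I G w u) v + B u (lieBracketL I G w v) = 0 := by
  have h := mvfderiv_bilinear B (x := (1 : G))
    ((contMDiff_adInv (I := I) u).mdifferentiableAt (by simp))
    ((contMDiff_adInv (I := I) v).mdifferentiableAt (by simp)) (w : E)
  simp only [hB] at h
  rw [mvfderiv_const, mvfderiv_adInv_one, mvfderiv_adInv_one, adInv_one, adInv_one] at h
  simp only [map_neg, neg_apply] at h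
  change (0 : ℝ) = _ at h
  linarith

/-- The Lie algebra of a commutative group is abelian. -/
lemma lieBracketL_of_comm (hG : ∀ x y : G, x * y = y * x) (u v : E) : lieBracketL I G u v = 0 := by
  -- Left and right translations coincide, so the adjoint action is constant and its derivative,
  -- minus the bracket, is zero.
  have h1 : ∀ x : G, adInv I x v = v := by
    intro x
    have : rightD I x 1 = leftD I x 1 := by
      unfold rightD leftD
      congr 1
      ext z
      exact hG z x
    rw [adInv_eq, this, leftD_inv_self_left]
  have h2 := mvfderiv_adInv_one (I := I) (G := G) v u
  simp only [h1] at h2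
  rw [mvfderiv_const] at h2
  exact neg_eq_zero.1 h2.symm

end LeftInvariant

/-! ### Invariant scalar products by Haar averaging. -/

section Average

open MeasureTheory

variable {E : Type*} [NormedAddCommGroup E] [NormedSpace ℝ E] [FiniteDimensional ℝ E]

variable (E) in
/-- A finite-dimensional space carries a scalar product. -/
lemma exists_scalarProduct : ∃ B : E →L[ℝ] E →L[ℝ] ℝ,
    (∀ u v, B u v = B v u) ∧ ∀ v, v ≠ 0 → 0 < B v v := by
  let e : E ≃L[ℝ] EuclideanSpace ℝ (Fin (Module.finrank ℝ E)) := toEuclidean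
  let e' : E →L[ℝ] EuclideanSpace ℝ (Fin (Module.finrank ℝ E)) := e
  refine ⟨(ContinuousLinearMap.precomp ℝ e').comp ((innerSL ℝ).comp e'),
    fun u v ↦ ?_, fun v hv ↦ ?_⟩
  · exact real_inner_comm (e v) (e u)
  · exact (real_inner_self_pos (x := e v)).2 (by simpa using hv)

variable {HM : Type*} [TopologicalSpace HM] {I : ModelWithCorners ℝ E HM} [I.Boundaryless]
  {G : Type*} [TopologicalSpace G] [ChartedSpace HM G] [Group G] [LieGroup I ∞ G]

variable (I G) in
/-- The Lie algebra of a compact Lie group carries an invariant scalar product. -/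
lemma exists_invariant_scalarProduct [CompactSpace G] : ∃ B : E →L[ℝ] E →L[ℝ] ℝ,
    (∀ u v, B u v = B v u) ∧ (∀ v, v ≠ 0 → 0 < B v v) ∧
      ∀ u v w, B (lieBracketL I G w u) v + B u (lieBracketL I G w v) = 0 := by
  obtain ⟨B₀, hsymm, hpos⟩ := exists_scalarProduct E
  borelize G
  have : IsTopologicalGroup G := topologicalGroup_of_lieGroup I ∞
  let μ : Measure G := Measure.haar
  have hc : ∀ u v : E, Continuous (fun x : G ↦ B₀ (adInv I x u) (adInv I x v)) := fun u v ↦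
    (B₀.continuous.comp (contMDiff_adInv u).continuous).clm_apply (contMDiff_adInv v).continuous
  have hi : ∀ u v : E, Integrable (fun x : G ↦ B₀ (adInv I x u) (adInv I x v)) μ := fun u v ↦
    (hc u v).integrable_of_hasCompactSupport (HasCompactSupport.of_compactSpace _)
  let B : E →L[ℝ] E →L[ℝ] ℝ := LinearMap.toContinuousBilinearMap (LinearMap.mk₂ ℝ
    (fun u v : E ↦ ∫ x : G, B₀ (adInv I x u) (adInv I x v) ∂μ)
    (fun u v w ↦ by simp only [adInv_add, map_add, add_apply]; exact integral_add (hi _ _) (hi _ _))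
    (fun c v w ↦ by simp only [adInv_smul, map_smul, smul_apply]; exact integral_smul _ _)
    (fun u v w ↦ by simp only [adInv_add, map_add]; exact integral_add (hi _ _) (hi _ _))
    (fun c v w ↦ by simp only [adInv_smul, map_smul]; exact integral_smul _ _))
  have hBdef : ∀ u v, B u v = ∫ x : G, B₀ (adInv I x u) (adInv I x v) ∂μ := fun _ _ ↦ rfl
  have hpos' : ∀ v, 0 ≤ B₀ v v := fun v ↦ by
    rcases eq_or_ne v 0 with rfl | hv
    · simp
    · exact (hpos v hv).le
  refine ⟨B, fun u v ↦ ?_, fun v hv ↦ ?_, invariant_of_adInv B fun y u v ↦ ?_⟩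
  · simp only [hBdef]
    exact integral_congr_ae (Eventually.of_forall fun x ↦ hsymm _ _)
  · rw [hBdef]
    -- The integrand is continuous and nonnegative, and at the identity it equals `B₀ v v > 0`.
    refine (hc v v).integral_pos_of_hasCompactSupport_nonneg_nonzero
      (HasCompactSupport.of_compactSpace _) (fun x ↦ hpos' _) (x := 1) ?_
    rw [adInv_one]
    exact (hpos v hv).ne'
  · simp only [hBdef, adInv_adInv]
    -- Acting by `y` first turns the integrand at `x` into its value at `y * x`.
    exact integral_mul_left_eq_self (fun x : G ↦ B₀ (adInv I x u) (adInv I x v)) y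

end Average

/-! ### The algebraic model on `𝔥 × 𝔥` and its two torsion identities. -/

namespace LinearHermitian

section Complexification

variable {E : Type*} [NormedAddCommGroup E] [NormedSpace ℝ E] (c : E →L[ℝ] E →L[ℝ] E)

/-- The Hermitian structure on `E × E` with `J (x, y) = (-y, x)` induced by a scalar product
on `E`. -/
def ofScalarProduct (B : E →L[ℝ] E →L[ℝ] ℝ) (hsymm : ∀ u v, B u v = B v u)
    (hpos : ∀ v, v ≠ 0 → 0 < B v v) : LinearHermitian (E × E) where
  inner := B.bilinearComp (.fst ℝ E E) (.fst ℝ E E) + B.bilinearComp (.snd ℝ E E) (.snd ℝ E E)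
  symm u v := by simp [hsymm u.1, hsymm u.2]
  pos v hv := by
    have hnn : ∀ v, 0 ≤ B v v := fun v ↦ by
      rcases eq_or_ne v 0 with rfl | h
      · simp
      · exact (hpos v h).le
    simp only [add_apply, ContinuousLinearMap.bilinearComp_apply, ContinuousLinearMap.coe_fst',
      ContinuousLinearMap.coe_snd']
    by_cases h1 : v.1 = 0
    · have h2 : v.2 ≠ 0 := fun h2 ↦ hv (Prod.ext h1 h2)
      linarith [hnn v.1, hpos _ h2]
    · linarith [hpos _ h1, hnn v.2]
  J := (-ContinuousLinearMap.snd ℝ E E).prod (.fst ℝ E E)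
  J_sq v := by ext <;> simp
  J_isometry u v := by simp [add_comm]

/-- The product of the Lie algebra with structure constants `c` and of an abelian Lie algebra. -/
def bracketFst : E × E →L[ℝ] E × E →L[ℝ] E × E :=
  (ContinuousLinearMap.postcomp (E × E) (.inl ℝ E E)).comp
    (c.bilinearComp (.fst ℝ E E) (.fst ℝ E E))

lemma bracketFst_apply (u v : E × E) : bracketFst c u v = (c u.1 v.1, 0) := rfl

/-- The first factor acting on both factors by the adjoint action. -/
def adFst : E × E →L[ℝ] E × E →L[ℝ] E × E :=
  (ContinuousLinearMap.postcomp (E × E) (.inl ℝ E E)).comp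
      (c.bilinearComp (.fst ℝ E E) (.fst ℝ E E))
    + (ContinuousLinearMap.postcomp (E × E) (.inr ℝ E E)).comp
      (c.bilinearComp (.fst ℝ E E) (.snd ℝ E E))

lemma adFst_apply (u v : E × E) : adFst c u v = (c u.1 v.1, c u.1 v.2) := by
  simp [adFst]

variable {c} {B : E →L[ℝ] E →L[ℝ] ℝ} (hsymm : ∀ u v, B u v = B v u)
  (hpos : ∀ v, v ≠ 0 → 0 < B v v)

lemma ofScalarProduct_inner (u v : E × E) :
    (ofScalarProduct B hsymm hpos).inner u v = B u.1 v.1 + B u.2 v.2 := rfl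

lemma ofScalarProduct_J (u : E × E) : (ofScalarProduct B hsymm hpos).J u = (-u.2, u.1) := rfl

variable (hskew : ∀ u v, c u v = -c v u) (hinv : ∀ u v w, B (c w u) v + B u (c w v) = 0)

-- Skewness of `c` and invariance of `B` are two adjacent transpositions, hence `B (c x y) z` is
-- alternating. The five nontrivial permutations serve as rewriting rules to a normal form.
include hsymm hskew hinv in
lemma invariant_perm (x y z : E) : B (c y x) z = -B (c x y) z ∧ B (c x z) y = -B (c x y) z ∧
    B (c z x) y = B (c x y) z ∧ B (c y z) x = B (c x y) z ∧ B (c z y) x = -B (c x y) z := by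
  have h1 : ∀ x y z, B (c y x) z = -B (c x y) z := fun x y z ↦ by rw [hskew]; simp
  have h2 : ∀ x y z, B (c x z) y = -B (c x y) z := fun x y z ↦ by
    have := hinv z y x
    rw [hsymm z] at this
    linarith
  have h3 := h1 y x z
  refine ⟨h1 x y z, h2 x y z, ?_, ?_, ?_⟩
  · rw [h1, h2, neg_neg]
  · rw [h2, h1, neg_neg]
  · rw [h1, h2, h1, neg_neg]

-- `ω` pairs the two factors and the bracket stays in the first, so every term involves an even
-- number of second components. After permutation only four values of the alternating form remain,
-- with coefficients that sum to `-B (c u.1 v.1) w.1`.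
include hskew hinv in
lemma gauduchonForm_two (u v w : E × E) :
    (ofScalarProduct B hsymm hpos).gauduchonForm (bracketFst c) 2 u v w =
      (ofScalarProduct B hsymm hpos).inner (-bracketFst c u v) w := by
  have hp := invariant_perm hsymm hskew hinv
  simp only [gauduchonForm, dFundPlus, dFund, nijenhuis, ofScalarProduct_inner, ofScalarProduct_J,
    bracketFst_apply, map_neg, map_add, map_sub, neg_apply, add_apply, sub_apply, map_zero,
    zero_apply, neg_zero]
  simp only [hp u.1 v.1 w.1, hp u.1 v.2 w.2, hp u.2 v.1 w.2, hp u.2 v.2 w.1]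
  ring

-- The same four values occur as for `t = 2`; here those with second components in `u, w` or in `v,
-- w` survive as well, and they are the mixed torsion of the diagonal adjoint action.
include hskew hinv in
lemma gauduchonForm_neg_two (u v w : E × E) :
    (ofScalarProduct B hsymm hpos).gauduchonForm (bracketFst c) (-2) u v w =
      (ofScalarProduct B hsymm hpos).inner
        (adFst c u v - adFst c v u - bracketFst c u v) w := by
  have hp := invariant_perm hsymm hskew hinv
  simp only [gauduchonForm, dFundPlus, dFund, nijenhuis, ofScalarProduct_inner, ofScalarProduct_J,
    bracketFst_apply, adFst_apply, map_neg, map_add, map_sub, neg_apply, add_apply, sub_apply,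
    map_zero, zero_apply, neg_zero]
  simp only [hp u.1 v.1 w.1, hp u.1 v.2 w.2, hp u.2 v.1 w.2, hp u.2 v.2 w.1]
  ring

end Complexification

end LinearHermitian

/-! ### Lie algebra of a product group and of its factors. -/

section Product

variable {E : Type*} [NormedAddCommGroup E] [NormedSpace ℝ E] [FiniteDimensional ℝ E]
  {HM : Type*} [TopologicalSpace HM] {I : ModelWithCorners ℝ E HM} [I.Boundaryless]
  {G : Type*} [TopologicalSpace G] [ChartedSpace HM G] [Group G] [LieGroup I ∞ G]
  {E' : Type*} [NormedAddCommGroup E'] [NormedSpace ℝ E'] [FiniteDimensional ℝ E']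
  {HM' : Type*} [TopologicalSpace HM'] {I' : ModelWithCorners ℝ E' HM'} [I'.Boundaryless]
  {G' : Type*} [TopologicalSpace G'] [ChartedSpace HM' G'] [Group G'] [LieGroup I' ∞ G']

lemma leftD_prod (p q : G × G') (u : E × E') :
    leftD (I.prod I') p q u = (leftD I p.1 q.1 u.1, leftD I' p.2 q.2 u.2) := by
  have h : (fun z : G × G' ↦ p * z) = Prod.map (fun z ↦ p.1 * z) (fun z ↦ p.2 * z) := rfl
  unfold leftD
  rw [h]
  exact congrArg (fun L : E × E' →L[ℝ] E × E' ↦ L u)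
    (mfderiv_prodMap (mdifferentiableAt_mul_left p.1 q.1) (mdifferentiableAt_mul_left p.2 q.2))

/-- The projections relate left-invariant fields to left-invariant fields, so naturality of the
bracket applies to each. -/
lemma lieBracketL_prod (u v : E × E') : lieBracketL (I.prod I') (G × G') u v =
    (lieBracketL I G u.1 v.1, lieBracketL I' G' u.2 v.2) := by
  have h1 := mfderiv_mlieBracket_of_related (φ := (Prod.fst : G × G' → G)) contMDiff_fst
    (isSmoothField_leftField (I := I.prod I') u) (isSmoothField_leftField (I := I.prod I') v)
    (isSmoothField_leftField (I := I) u.1) (isSmoothField_leftField (I := I) v.1)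
    (fun x ↦ by rw [mfderiv_fst]; exact congrArg Prod.fst (leftD_prod x 1 u))
    (fun x ↦ by rw [mfderiv_fst]; exact congrArg Prod.fst (leftD_prod x 1 v)) 1
  have h2 := mfderiv_mlieBracket_of_related (φ := (Prod.snd : G × G' → G')) contMDiff_snd
    (isSmoothField_leftField (I := I.prod I') u) (isSmoothField_leftField (I := I.prod I') v)
    (isSmoothField_leftField (I := I') u.2) (isSmoothField_leftField (I := I') v.2)
    (fun x ↦ by rw [mfderiv_snd]; exact congrArg Prod.snd (leftD_prod x 1 u))
    (fun x ↦ by rw [mfderiv_snd]; exact congrArg Prod.snd (leftD_prod x 1 v)) 1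
  rw [mfderiv_fst] at h1
  rw [mfderiv_snd] at h2
  exact Prod.ext h1 h2

lemma mem_lieFst_iff (u : E × E') : (u : GroupLieAlgebra (I.prod I') (G × G')) ∈ lieFst I G I' G' ↔
    u.2 = 0 := by
  have h : (mfderiv I (I.prod I') (fun h : G ↦ (h, (1 : G'))) (1 : G) : E →L[ℝ] E × E') =
    ContinuousLinearMap.inl ℝ E E' := mfderiv_prod_left
  constructor
  · rintro ⟨x, rfl⟩
    exact congrArg (fun L : E →L[ℝ] E × E' ↦ (L x).2) h
  · intro hu
    refine ⟨u.1, ?_⟩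
    refine (congrArg (fun L : E →L[ℝ] E × E' ↦ L u.1) h).trans ?_
    exact Prod.ext rfl hu.symm

lemma mem_lieSnd_iff (u : E × E') : (u : GroupLieAlgebra (I.prod I') (G × G')) ∈ lieSnd I G I' G' ↔
    u.1 = 0 := by
  have h : (mfderiv I' (I.prod I') (fun h : G' ↦ ((1 : G), h)) (1 : G') : E' →L[ℝ] E × E') =
    ContinuousLinearMap.inr ℝ E E' := mfderiv_prod_right
  constructor
  · rintro ⟨x, rfl⟩
    exact congrArg (fun L : E' →L[ℝ] E × E' ↦ (L x).1) h
  · intro hu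
    refine ⟨u.2, ?_⟩
    refine (congrArg (fun L : E' →L[ℝ] E × E' ↦ L u.2) h).trans ?_
    exact Prod.ext hu.symm rfl

end Product

/-! ### Left-invariant structures and connections in the left framing. -/

section LeftInvariant

variable {E : Type*} [NormedAddCommGroup E] [NormedSpace ℝ E] [FiniteDimensional ℝ E]
  {HM : Type*} [TopologicalSpace HM] {I : ModelWithCorners ℝ E HM} [I.Boundaryless]
  {G : Type*} [TopologicalSpace G] [ChartedSpace HM G] [Group G] [LieGroup I ∞ G]
  {V : Type*} [NormedAddCommGroup V] [NormedSpace ℝ V] [FiniteDimensional ℝ V]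
  (ψ : E ≃L[ℝ] V) (h : LinearHermitian V)

lemma trans_coframe_leftD (a x : G) (u : E) :
    ((leftFraming I G).trans ψ).coframe (a * x) (leftD I a x u) =
      ((leftFraming I G).trans ψ).coframe x u :=
  congrArg ψ (leftEquiv_leftD a x u)

lemma trans_coframe_one (u : E) : ((leftFraming I G).trans ψ).coframe (1 : G) u = ψ u := by
  refine congrArg ψ ((leftFraming_coframe 1 u).trans ?_)
  rw [inv_one, leftD_one]
  rfl

lemma isLeftInvariant_hermitian :
    (((leftFraming I G).trans ψ).hermitian h).IsLeftInvariant where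
  metric a x u v := by
    rw [Framing.hermitian_inner, Framing.hermitian_inner]
    exact congrArg₂ (fun p q : V ↦ h.inner p q) (trans_coframe_leftD ψ a x u)
      (trans_coframe_leftD ψ a x v)
  complex a x u := by
    apply (((leftFraming I G).trans ψ).coframe (a * x)).injective
    rw [Framing.coframe_J]
    refine (congrArg h.J (trans_coframe_leftD ψ a x u)).trans ?_
    refine Eq.trans ?_ (trans_coframe_leftD ψ a x _).symm
    exact (((leftFraming I G).trans ψ).coframe_J h x u).symm

variable {ψ h}

/-- Left-invariant fields are the constant fields of the framing, so their derivative term vanishes.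
By uniqueness `Γ` can be read off from any Gauduchon connection, which decides whether it is
trivial. -/
lemma AlmostHermitianStructure.IsGauduchon.coframe_cov_mulInvariant
    {S : AlmostHermitianStructure I G} {t : ℝ} {Γ : V →L[ℝ] V →L[ℝ] V}
    {D : CovariantDerivative I E (fun x : G ↦ TangentSpace I x)}
    (hD : S.IsGauduchon t D) (hD' : S.IsGauduchon t (((leftFraming I G).trans ψ).conn Γ))
    (u v : GroupLieAlgebra I G) (x : G) :
    ((leftFraming I G).trans ψ).coframe x
      (cov D (mulInvariantVectorField u) (mulInvariantVectorField v) x) =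
      Γ (ψ (u : E)) (ψ (v : E)) := by
  let T := (leftFraming I G).trans ψ
  have hf : ∀ u : E, (leftField u : VecField I G) = T.field (ψ u) := by
    intro u
    funext y
    show leftField u y = leftField (ψ.symm (ψ u)) y
    rw [ψ.symm_apply_apply]
  have h1 := hD.cov_unique T hD' (T.isSmoothField_field (ψ u)) (T.isSmoothField_field (ψ v))
  rw [← leftField_eq, ← leftField_eq]
  refine Eq.trans ?_ ((T.comp_cov Γ (T.field (ψ u)) (T.field (ψ v)) x).trans ?_)
  · rw [← h1]
    exact congrArg₂ (fun X Y : VecField I G ↦ T.comp (cov D X Y) x) (hf u) (hf v)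
  · rw [T.comp_field, T.comp_field, mvfderiv_const]
    exact zero_add _

lemma AlmostHermitianStructure.IsGauduchon.isTrivialConnection
    {S : AlmostHermitianStructure I G} {t : ℝ}
    {D : CovariantDerivative I E (fun x : G ↦ TangentSpace I x)}
    (hD : S.IsGauduchon t D) (hD' : S.IsGauduchon t (((leftFraming I G).trans ψ).conn 0)) :
    IsTrivialConnection D := by
  intro u v x
  apply (((leftFraming I G).trans ψ).coframe x).injective
  rw [hD.coframe_cov_mulInvariant hD', map_zero]
  rfl

end LeftInvariant

end AlmostHermitian

end

/-! ### Assembly on `H × A`. -/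

open AlmostHermitian in
theorem mainTheorem1 (n : ℕ)
    {EH : Type*} [NormedAddCommGroup EH] [NormedSpace ℝ EH] [FiniteDimensional ℝ EH]
    (hEH : Module.finrank ℝ EH = n)
    {EA : Type*} [NormedAddCommGroup EA] [NormedSpace ℝ EA] [FiniteDimensional ℝ EA]
    (hEA : Module.finrank ℝ EA = n)
    (H : Type*) [TopologicalSpace H] [ChartedSpace EH H] [Group H] [LieGroup 𝓘(ℝ, EH) ∞ H]
    [CompactSpace H]
    (A : Type*) [TopologicalSpace A] [ChartedSpace EA A] [CommGroup A]
    [LieGroup 𝓘(ℝ, EA) ∞ A] :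
    ∃ S : AlmostHermitian.AlmostHermitianStructure (𝓘(ℝ, EH).prod 𝓘(ℝ, EA)) (H × A),
      S.IsLeftInvariant ∧
      -- `J` is totally real with respect to `𝔥`: `J 𝔥 = 𝔞`
      (AlmostHermitian.lieFst 𝓘(ℝ, EH) H 𝓘(ℝ, EA) A).map (S.J 1).toLinearMap
        = AlmostHermitian.lieSnd 𝓘(ℝ, EH) H 𝓘(ℝ, EA) A ∧
      -- and `𝔥` is orthogonal to `𝔞`
      (∀ u ∈ AlmostHermitian.lieFst 𝓘(ℝ, EH) H 𝓘(ℝ, EA) A,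
        ∀ v ∈ AlmostHermitian.lieSnd 𝓘(ℝ, EH) H 𝓘(ℝ, EA) A, S.g.inner 1 u v = 0) ∧
      -- the Gauduchon connection for `t = 2`
      (∃ D, S.IsGauduchon 2 D) ∧
      (∀ D, S.IsGauduchon 2 D →
        AlmostHermitian.IsTrivialConnection D ∧
        AlmostHermitian.IsTotallySkew (S.torsionForm D) ∧
        AlmostHermitian.IsClosedThree (S.torsionForm D)) ∧
      -- the Gauduchon connection for `t = -2`
      (∃ D, S.IsGauduchon (-2) D) ∧
      (∀ D, S.IsGauduchon (-2) D →
        AlmostHermitian.IsFlat D ∧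
        ((∃ u v : GroupLieAlgebra 𝓘(ℝ, EH) H, ⁅u, v⁆ ≠ 0) →
          ¬ AlmostHermitian.IsTrivialConnection D)) := by
  obtain ⟨B, hsymm, hpos, hinv⟩ := exists_invariant_scalarProduct 𝓘(ℝ, EH) H
  let c := lieBracketL 𝓘(ℝ, EH) H
  have hskew : ∀ u v, c u v = -c v u := lieBracketL_skew
  have hjac : ∀ u v w, c u (c v w) = c (c u v) w + c v (c u w) := lieBracketL_jacobi
  -- An arbitrary linear isomorphism will do, as the bracket of `𝔞` vanishes; this is where equality
  -- of dimensions enters.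
  let φ : EA ≃L[ℝ] EH := ContinuousLinearEquiv.ofFinrankEq (hEA.trans hEH.symm)
  let ψ : (EH × EA) ≃L[ℝ] EH × EH := (ContinuousLinearEquiv.refl ℝ EH).prodCongr φ
  let h := LinearHermitian.ofScalarProduct B hsymm hpos
  let T := (leftFraming (𝓘(ℝ, EH).prod 𝓘(ℝ, EA)) (H × A)).trans ψ
  have hT : T.bracket = LinearHermitian.bracketFst c := by
    refine ContinuousLinearMap.ext fun u ↦ ContinuousLinearMap.ext fun v ↦ ?_
    refine (congrArg ψ (lieBracketL_prod (I := 𝓘(ℝ, EH)) (G := H) (I' := 𝓘(ℝ, EA)) (G' := A)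
      (ψ.symm u) (ψ.symm v))).trans (Prod.ext rfl ?_)
    exact (congrArg φ (lieBracketL_of_comm (I := 𝓘(ℝ, EA)) (G := A) mul_comm _ _)).trans
      (map_zero φ)
  let S := T.hermitian h
  have h2 : S.IsGauduchon 2 (T.conn 0) := by
    refine T.isGauduchon_conn h 2 0 (by simp) (by simp) fun u v w ↦ ?_
    rw [hT, LinearHermitian.gauduchonForm_two hsymm hpos hskew hinv]
    simp [h]
  have hm2 : S.IsGauduchon (-2) (T.conn (LinearHermitian.adFst c)) := by
    refine T.isGauduchon_conn h (-2) _ (fun u v w ↦ ?_) (fun u v ↦ ?_) fun u v w ↦ ?_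
    · simp only [h, LinearHermitian.ofScalarProduct_inner, LinearHermitian.adFst_apply]
      linarith [hinv v.1 w.1 u.1, hinv v.2 w.2 u.1]
    · simp [h, LinearHermitian.ofScalarProduct_J, LinearHermitian.adFst_apply]
    · rw [hT, LinearHermitian.gauduchonForm_neg_two hsymm hpos hskew hinv]
  have htor : ∀ D, S.IsGauduchon 2 D → S.torsionForm D = fun x u v w ↦
      h.inner (-T.bracket (T.coframe x u) (T.coframe x v)) (T.coframe x w) := by
    intro D hD
    rw [hD.torsionForm_unique T h2]
    funext x u v w
    exact (T.torsionForm_conn h 0 x u v w).trans (by simp)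
  refine ⟨S, isLeftInvariant_hermitian ψ h, ?_, ?_, ⟨_, h2⟩, fun D hD ↦ ⟨?_, ?_, ?_⟩, ⟨_, hm2⟩,
    fun D hD ↦ ⟨?_, ?_⟩⟩
  · have hJ : ∀ u : EH × EA, ψ (S.J (1 : H × A) u) = h.J (ψ u) := fun u ↦
      (trans_coframe_one ψ _).symm.trans
        ((T.coframe_J h 1 u).trans (congrArg h.J (trans_coframe_one ψ u)))
    ext w
    rw [Submodule.mem_map]
    refine Iff.trans ?_ (mem_lieSnd_iff w).symm
    constructor
    · rintro ⟨u, hu, rfl⟩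
      refine (congrArg Prod.fst (hJ u)).trans ?_
      have hu' := (mem_lieFst_iff u).1 hu
      show -φ (u : EH × EA).2 = 0
      rw [hu', map_zero, neg_zero]
    · intro hw
      -- In these coordinates `J (x, 0) = (0, φ⁻¹ x)`, which dictates the preimage.
      refine ⟨((φ (w : EH × EA).2, 0) : EH × EA), (mem_lieFst_iff _).2 rfl, ?_⟩
      refine ψ.injective ((hJ _).trans ?_)
      refine Prod.ext ?_ rfl
      show -φ 0 = (w : EH × EA).1
      rw [hw, map_zero, neg_zero]
  · intro u hu v hv
    have hu' := (mem_lieFst_iff u).1 hu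
    have hv' := (mem_lieSnd_iff v).1 hv
    rw [T.hermitian_inner]
    refine (congrArg₂ (fun p q : EH × EH ↦ h.inner p q) (trans_coframe_one ψ u)
      (trans_coframe_one ψ v)).trans ?_
    show B (u : EH × EA).1 (v : EH × EA).1 + B (φ (u : EH × EA).2) (φ (v : EH × EA).2) = 0
    rw [hu', hv']
    simp
  · exact hD.isTrivialConnection h2
  · rw [htor D hD]
    intro x u v w
    have hp := LinearHermitian.invariant_perm hsymm hskew hinv (T.coframe x u).1
      (T.coframe x v).1 (T.coframe x w).1
    simp only [hT, h, LinearHermitian.ofScalarProduct_inner, LinearHermitian.bracketFst_apply,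
      Prod.neg_mk, map_neg, neg_apply, neg_zero, map_zero, zero_apply, hp]
    simp
  · rw [htor D hD]
    refine T.isClosedThree_bracket h (fun u v ↦ ?_) (fun u v w ↦ ?_) fun u v w ↦ ?_
    · rw [hT, LinearHermitian.bracketFst_apply, LinearHermitian.bracketFst_apply, hskew]
      simp
    · have hp := LinearHermitian.invariant_perm hsymm hskew hinv u.1 v.1 w.1
      simp only [hT, h, LinearHermitian.ofScalarProduct_inner, LinearHermitian.bracketFst_apply,
        map_zero, zero_apply, add_zero]
      rw [hsymm u.1]
      exact hp.2.2.2.1.symm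
    · simp only [hT, LinearHermitian.bracketFst_apply, Prod.mk_add_mk, add_zero]
      rw [hjac]
  · refine hD.isFlat_of_isFlat T hm2 (T.isFlat_conn _ fun u v w ↦ ?_)
    simp only [hT, LinearHermitian.bracketFst_apply, LinearHermitian.adFst_apply]
    rw [hjac u.1 v.1 w.1, hjac u.1 v.1 w.2]
    simp
  · rintro ⟨u, v, huv⟩ htriv
    -- On left-invariant fields from `𝔥` the connection is `∇_u v = [u, v]`, so triviality would
    -- force the bracket of `𝔥` to vanish.
    have h1 := hD.coframe_cov_mulInvariant hm2 ((u, 0) : EH × EA) ((v, 0) : EH × EA) 1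
    have h0 := ((congrArg (T.coframe 1) (htriv ((u, 0) : EH × EA) ((v, 0) : EH × EA) 1)).trans
      (map_zero _)).symm.trans h1
    exact huv (congrArg Prod.fst (h0.trans (LinearHermitian.adFst_apply c _ _))).symm
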